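/- **Setting.** Let $D\subset\mathbb{R}^d$ be compact, with Lebesgue measure and $L^2(D)$-norm $\|\cdot\|$. For every $N\in\mathbb{N}$ let $\Xi_N=\{t^N_1,\dots,t^N_N\}\subset D$ be a mesh of $N$ distinct points. Let $V$ be a linear space of square-integrable functions $D\to\mathbb{R}$ containing all continuous functions, and assume that the meshes satisfy the *Riemann scaling property* on $V$: $$\frac1N\sum_{i=1}^N f(t^N_i)^2\;\longrightarrow\;\int_D f(t)^2\,dt\qquad(N\to\infty)\quad\text{for all } f\in V.$$ Let $m\in V$ with $\|m\|\neq 0$. For a covariance function (symmetric, positive semi-definite function) $k_0:D\times D\to\mathbb{R}$ put $$P=\mathcal N(0,\Sigma),\qquad Q=\mathcal N(m_N,\Sigma)\qquad\text{on }\mathbb{R}^N,\qquad \Sigma_{ij}=k_0(t^N_i,t^N_j),\quad m_N=(m(t^N_1),\dots,m(t^N_N))^\top .$$ Let $k(x,y)=\exp\!\big(-\tfrac12\gamma_N^{-2}\|x-y\|_2^2\big)$ on $\mathbb{R}^N$, with RKHS $\mathcal H_k$, where $\gamma_N=\Omega(N^\alpha)$ for some $\alpha>1/2$, i.e. there is $c>0$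 with $|\gamma_N|\ge cN^\alpha$ for all large $N$. Write $$\mathrm{MMD}_k(P,Q)=\sup_{\|f\|_{\mathcal H_k}\le 1}\Big|\int f\,dP-\int f\,dQ\Big|,\qquad \xi_2=\mathrm{Var}_{z,z'}[h(z,z')],$$ where $z=(x,y)$ and $z'=(x',y')$ are independent with law $P\otimes Q$ and $h(z,z')=k(x,x')+k(y,y')-k(x,y')-k(x',y)$. Below, $a_N\sim b_N$ means $a_N/b_N\to1$ as $N\to\infty$. **Proposition 3.1.** 1. (White noise.) If $k_0(s,t)=\delta_{st}$, then $$\frac{\mathrm{MMD}_k(P,Q)^2}{\sqrt{\xi_2}}\;\sim\;\frac{\sqrt N\,\|m\|^2}{2\sqrt{1+\|m\|^2}} .$$ 2. If $k_0$ is continuous and its covariance operator $C_{k_0}:L^2(D)\to L^2(D)$, $C_{k_0}y(t)=\int_D k_0(s,t)y(s)\,ds$, is non-zero, then $$\frac{\mathrm{MMD}_k(P,Q)^2}{\sqrt{\xi_2}}\;\sim\;\frac{\|m\|^2}{2\sqrt{\|C_{k_0}\|_{HS}^2+\|C_{k_0}^{1/2}m\|^2}} ,$$ where $\|\cdot\|_{HS}$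 is the Hilbert-Schmidt norm and $C_{k_0}^{1/2}$ the non-negative square root. -/

import Mathlib

open MeasureTheory ProbabilityTheory Filter Topology Asymptotics

noncomputable section

namespace KernelTest

/-! ### Kernels, maximum mean discrepancy and the variance `ξ₂` -/

/-- A real kernel `k`, written as an operator-valued kernel matrix (`k x y` acts on `ℝ` by
multiplication), which is the format in which Mathlib builds reproducing kernel Hilbert spaces. -/
def kernelMatrix {X : Type*} (k : X → X → ℝ) : Matrix X X (ℝ →L[ℝ] ℝ) :=
  Matrix.of fun x y => k x y • ContinuousLinearMap.id ℝ ℝ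

/-- The maximum mean discrepancy
`MMD_k(P, Q) = sup { |∫ f dP - ∫ f dQ| : f ∈ H_k, ‖f‖_{H_k} ≤ 1 }`,
where `H_k` is the reproducing kernel Hilbert space of the positive definite kernel `k`. -/
def mmd {X : Type*} [MeasurableSpace X] (k : X → X → ℝ) [Fact (kernelMatrix k).PosSemidef]
    (P Q : Measure X) : ℝ :=
  ⨆ f : {f : RKHS.OfKernel (kernelMatrix k) // ‖f‖ ≤ 1},
    |∫ x, (f : RKHS.OfKernel (kernelMatrix k)) x ∂P
      - ∫ x, (f : RKHS.OfKernel (kernelMatrix k)) x ∂Q|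

/-- `h(z, z') = k(x, x') + k(y, y') - k(x, y') - k(x', y)` for `z = (x, y)`, `z' = (x', y')`. -/
def hCore {X : Type*} (k : X → X → ℝ) (z z' : X × X) : ℝ :=
  k z.1 z'.1 + k z.2 z'.2 - k z.1 z'.2 - k z'.1 z.2

/-- `ξ₂ = Var_{z, z'}[h(z, z')]` for independent `z, z'` with law `P ⊗ Q`. -/
def xi₂ {X : Type*} [MeasurableSpace X] (k : X → X → ℝ) (P Q : Measure X) : ℝ :=
  Var[fun w : (X × X) × (X × X) => hCore k w.1 w.2; (P.prod Q).prod (P.prod Q)]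

/-- The signal-to-noise ratio `MMD_k(P, Q)² / √ξ₂`. -/
def signalToNoise {X : Type*} [MeasurableSpace X] (k : X → X → ℝ)
    [Fact (kernelMatrix k).PosSemidef] (P Q : Measure X) : ℝ :=
  mmd k P Q ^ 2 / √(xi₂ k P Q)

/-- The Gauss kernel `exp (-½ γ⁻² ‖x - y‖²)` with bandwidth `γ`. -/
def gaussKernel {E : Type*} [NormedAddCommGroup E] (γ : ℝ) (x y : E) : ℝ :=
  Real.exp (-(1 / 2) * (γ ^ 2)⁻¹ * ‖x - y‖ ^ 2)

theorem gaussKernel_sum_nonneg {N : ℕ} (γ : ℝ) (v : EuclideanSpace ℝ (Fin N) →₀ ℝ) :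
    0 ≤ v.sum fun x a => v.sum fun y b => gaussKernel γ y x * a * b := by
  set P := stdGaussian (EuclideanSpace ℝ (Fin N))
  set F : EuclideanSpace ℝ (Fin N) → EuclideanSpace ℝ (Fin N) → ℂ :=
    fun x z => Complex.exp ((inner ℝ z (γ⁻¹ • x) : ℝ) * Complex.I) with hF
  have hint : ∀ x, Integrable (fun z => Complex.exp ((inner ℝ z x : ℝ) * Complex.I)) P := by
    intro x
    refine Integrable.of_bound (C := 1) (by fun_prop) (ae_of_all _ fun z => ?_)
    rw [Complex.norm_exp_ofReal_mul_I]
  have hmul : ∀ x y z, starRingEnd ℂ (F x z) * F y z =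
      Complex.exp ((inner ℝ z (γ⁻¹ • (y - x)) : ℝ) * Complex.I) := by
    intro x y z
    simp only [hF]
    rw [← Complex.exp_conj, ← Complex.exp_add]
    congr 1
    simp only [map_mul, Complex.conj_ofReal, Complex.conj_I, smul_sub, inner_sub_right]
    push_cast
    ring
  have hk : ∀ x y, ((gaussKernel γ y x : ℝ) : ℂ) = ∫ z, starRingEnd ℂ (F x z) * F y z ∂P := by
    intro x y
    have h := charFun_stdGaussian (E := EuclideanSpace ℝ (Fin N)) (γ⁻¹ • (y - x))
    rw [charFun_apply] at h
    simp_rw [hmul]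
    rw [h, gaussKernel]
    push_cast
    congr 1
    rw [norm_smul]
    simp only [norm_inv, Real.norm_eq_abs, Complex.ofReal_mul, mul_pow]
    rw [← Complex.ofReal_pow |γ|⁻¹, inv_pow, sq_abs]
    push_cast
    ring
  have key : ((v.sum fun x a => v.sum fun y b => gaussKernel γ y x * a * b : ℝ) : ℂ) =
      ∫ z, ((‖v.sum fun x a => (a : ℂ) * F x z‖ ^ 2 : ℝ) : ℂ) ∂P := by
    have h1 : ∀ z, ((‖v.sum fun x a => (a : ℂ) * F x z‖ ^ 2 : ℝ) : ℂ) =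
        ∑ x ∈ v.support, ∑ y ∈ v.support,
          ((v x : ℂ) * (v y : ℂ)) * (starRingEnd ℂ (F x z) * F y z) := by
      intro z
      push_cast
      rw [← Complex.conj_mul', Finsupp.sum, map_sum, Finset.sum_mul_sum]
      refine Finset.sum_congr rfl fun x _ => Finset.sum_congr rfl fun y _ => ?_
      rw [map_mul, Complex.conj_ofReal]
      ring
    simp_rw [h1]
    rw [integral_finsetSum]
    · simp only [Finsupp.sum]
      push_cast
      refine Finset.sum_congr rfl fun x _ => ?_
      rw [integral_finsetSum]
      · refine Finset.sum_congr rfl fun y _ => ?_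
        rw [integral_const_mul, ← hk]
        ring
      · intro y _
        simp_rw [hmul]
        exact (hint _).const_mul _
    · intro x _
      refine integrable_finsetSum _ fun y _ => ?_
      simp_rw [hmul]
      exact (hint _).const_mul _
  rw [integral_complex_ofReal] at key
  rw [Complex.ofReal_injective key]
  exact integral_nonneg fun z => by positivity

theorem gaussKernel_posSemidef {N : ℕ} (γ : ℝ) :
    (kernelMatrix (gaussKernel (E := EuclideanSpace ℝ (Fin N)) γ)).PosSemidef := by
  have h := (RKHS.posSemidef_tfae
    (K := kernelMatrix (gaussKernel (E := EuclideanSpace ℝ (Fin N)) γ))).out 0 2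
  refine h.mpr ⟨?_, fun v => ?_⟩
  · refine Matrix.IsHermitian.ext fun x y => ?_
    have h1 : star (ContinuousLinearMap.id ℝ ℝ) = ContinuousLinearMap.id ℝ ℝ :=
      star_one (ℝ →L[ℝ] ℝ)
    simp [kernelMatrix, gaussKernel, norm_sub_rev, h1]
  · refine (gaussKernel_sum_nonneg γ v).trans_eq ?_
    simp only [kernelMatrix, Matrix.of_apply, Finsupp.sum]
    refine Finset.sum_congr rfl fun x _ => Finset.sum_congr rfl fun y _ => ?_
    simp
    ring

instance gaussKernel_fact {N : ℕ} (γ : ℝ) :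
    Fact (kernelMatrix (gaussKernel (E := EuclideanSpace ℝ (Fin N)) γ)).PosSemidef :=
  ⟨gaussKernel_posSemidef γ⟩

/-! ### Covariance operators on `L²` -/

section CovarianceOperator

variable {α : Type*} [TopologicalSpace α] [CompactSpace α] [MeasurableSpace α] [BorelSpace α]

theorem integrable_covarianceFun (μ : Measure α) [IsFiniteMeasure μ] (k : C(α × α, ℝ))
    (y : Lp ℝ 2 μ) (t : α) : Integrable (fun s => k (s, t) * y s) μ := by
  have hy : Integrable y μ := (Lp.memLp y).integrable (by norm_num)
  exact hy.bdd_mul (c := ‖k‖) (k.continuous.comp (by fun_prop)).aestronglyMeasurable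
    (ae_of_all _ fun s => k.norm_coe_le_norm _)

variable [FirstCountableTopology α]

/-- The function `t ↦ ∫ k(s, t) y(s) ds`, for `k` continuous and `y ∈ L²`; it is continuous. -/
def covarianceFun (μ : Measure α) [IsFiniteMeasure μ] (k : C(α × α, ℝ)) (y : Lp ℝ 2 μ) :
    C(α, ℝ) where
  toFun t := ∫ s, k (s, t) * y s ∂μ
  continuous_toFun := by
    have hy : Integrable y μ := (Lp.memLp y).integrable (by norm_num)
    refine continuous_of_dominated (bound := fun s => ‖k‖ * ‖y s‖) ?_ ?_ ?_ ?_
    · intro t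
      exact ((k.continuous.comp (by fun_prop)).aestronglyMeasurable).mul hy.1
    · intro t
      refine ae_of_all _ fun s => ?_
      rw [norm_mul]
      exact mul_le_mul_of_nonneg_right (k.norm_coe_le_norm _) (norm_nonneg _)
    · exact hy.norm.const_mul _
    · exact ae_of_all _ fun s => by fun_prop

theorem covarianceFun_add (μ : Measure α) [IsFiniteMeasure μ] (k : C(α × α, ℝ))
    (y z : Lp ℝ 2 μ) :
    covarianceFun μ k (y + z) = covarianceFun μ k y + covarianceFun μ k z := by
  ext t
  simp only [covarianceFun, ContinuousMap.coe_mk, ContinuousMap.add_apply]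
  rw [← integral_add (integrable_covarianceFun μ k y t) (integrable_covarianceFun μ k z t)]
  refine integral_congr_ae ?_
  filter_upwards [Lp.coeFn_add y z] with s hs
  rw [hs, Pi.add_apply, mul_add]

theorem covarianceFun_smul (μ : Measure α) [IsFiniteMeasure μ] (k : C(α × α, ℝ))
    (c : ℝ) (y : Lp ℝ 2 μ) : covarianceFun μ k (c • y) = c • covarianceFun μ k y := by
  ext t
  simp only [covarianceFun, ContinuousMap.coe_mk, ContinuousMap.smul_apply, smul_eq_mul]
  rw [← integral_const_mul]
  refine integral_congr_ae ?_
  filter_upwards [Lp.coeFn_smul c y] with s hs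
  rw [hs, Pi.smul_apply, smul_eq_mul]
  ring

theorem norm_covarianceFun_le (μ : Measure α) [IsFiniteMeasure μ] (k : C(α × α, ℝ))
    (y : Lp ℝ 2 μ) :
    ‖covarianceFun μ k y‖ ≤ ‖k‖ * μ.real Set.univ ^ (1 / 2 : ℝ) * ‖y‖ := by
  have hy : Integrable y μ := (Lp.memLp y).integrable (by norm_num)
  have h1 : ∫ s, ‖y s‖ ∂μ ≤ μ.real Set.univ ^ (1 / 2 : ℝ) * ‖y‖ := by
    have h := eLpNorm_le_eLpNorm_mul_rpow_measure_univ (μ := μ) (p := 1) (q := 2)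
      (by norm_num) (Lp.memLp y).1
    have htop : eLpNorm y 2 μ * μ Set.univ ^ (1 / (1 : ENNReal).toReal - 1 / (2 : ENNReal).toReal)
        ≠ ⊤ := ENNReal.mul_ne_top (Lp.memLp y).2.ne
          (ENNReal.rpow_ne_top_of_nonneg (by norm_num) (measure_ne_top _ _))
    have h' := ENNReal.toReal_mono htop h
    rw [ENNReal.toReal_mul, ← ENNReal.toReal_rpow, ← Lp.norm_def] at h'
    rw [integral_norm_eq_lintegral_enorm hy.1, ← eLpNorm_one_eq_lintegral_enorm, mul_comm]
    refine h'.trans_eq ?_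
    rw [Measure.real]
    norm_num
  rw [ContinuousMap.norm_le _ (by positivity)]
  intro t
  calc ‖covarianceFun μ k y t‖ ≤ ∫ s, ‖k‖ * ‖y s‖ ∂μ := by
        refine norm_integral_le_of_norm_le (hy.norm.const_mul _) (ae_of_all _ fun s => ?_)
        rw [norm_mul]
        exact mul_le_mul_of_nonneg_right (k.norm_coe_le_norm _) (norm_nonneg _)
    _ ≤ ‖k‖ * μ.real Set.univ ^ (1 / 2 : ℝ) * ‖y‖ := by
        rw [integral_const_mul, mul_assoc]
        exact mul_le_mul_of_nonneg_left h1 (norm_nonneg _)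

/-- The covariance operator `C_k : L² → L²`, `(C_k y)(t) = ∫ k(s, t) y(s) ds`, of a continuous
function `k` on a compact space. -/
def covarianceOperator (μ : Measure α) [IsFiniteMeasure μ] (k : C(α × α, ℝ)) :
    Lp ℝ 2 μ →L[ℝ] Lp ℝ 2 μ :=
  LinearMap.mkContinuousOfExistsBound
    { toFun := fun y => ContinuousMap.toLp 2 μ ℝ (covarianceFun μ k y)
      map_add' := fun y z => by rw [covarianceFun_add, map_add]
      map_smul' := fun c y => by rw [covarianceFun_smul, map_smul, RingHom.id_apply] }
    ⟨‖(ContinuousMap.toLp 2 μ ℝ : C(α, ℝ) →L[ℝ] Lp ℝ 2 μ)‖ * (‖k‖ * μ.real Set.univ ^ (1 / 2 : ℝ)),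
      fun y => by
        refine ((ContinuousMap.toLp 2 μ ℝ : C(α, ℝ) →L[ℝ] Lp ℝ 2 μ).le_opNorm _).trans ?_
        rw [mul_assoc]
        exact mul_le_mul_of_nonneg_left (norm_covarianceFun_le μ k y) (norm_nonneg _)⟩

end CovarianceOperator

section Operators

variable {H : Type*} [NormedAddCommGroup H] [InnerProductSpace ℝ H] [CompleteSpace H]

/-- The Hilbert-Schmidt norm `(∑ ‖T eᵢ‖²)^{1/2}` of a Hilbert-Schmidt operator; the sum does not
depend on the orthonormal basis `(eᵢ)`. -/
def hilbertSchmidtNorm (T : H →L[ℝ] H) : ℝ :=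
  √(∑' i, ‖T ((exists_hilbertBasis ℝ H).choose_spec.choose i)‖ ^ 2)

open Classical in
/-- The square root `T^{1/2}` of a non-negative self-adjoint operator `T`: the unique non-negative
self-adjoint operator whose square is `T` (and `0` if `T` has no such root). -/
def operatorSqrt (T : H →L[ℝ] H) : H →L[ℝ] H :=
  if h : ∃ S : H →L[ℝ] H, S.IsPositive ∧ S ∘L S = T then h.choose else 0

end Operators

/-! ### Discretised Gaussian processes on a compact domain -/

section Mesh

variable {d : ℕ} {D : TopologicalSpace.Compacts (EuclideanSpace ℝ (Fin d))}

/-- Lebesgue measure on `D`. -/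
def lebesgueOn (D : TopologicalSpace.Compacts (EuclideanSpace ℝ (Fin d))) : Measure D :=
  (volume : Measure (EuclideanSpace ℝ (Fin d))).comap Subtype.val

instance isFiniteMeasure_lebesgueOn : IsFiniteMeasure (lebesgueOn D) := by
  constructor
  have hD : MeasurableSet (D : Set (EuclideanSpace ℝ (Fin d))) := D.isCompact.measurableSet
  have h := (MeasurableEmbedding.subtype_coe hD).comap_apply volume Set.univ
  refine lt_of_eq_of_lt h ?_
  rw [Set.image_univ]
  refine lt_of_eq_of_lt ?_ (D.isCompact.measure_lt_top (μ := volume))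
  congr 1
  ext x
  simp

/-- The Riemann scaling property of the meshes `{t N 0, …, t N (N-1)}`, for the functions in a
linear space `V` of square-integrable functions: `N⁻¹ ∑ᵢ f(tᵢ)² → ∫_D f²`. As point values enter,
`V` consists of functions and not of classes of functions modulo null sets. -/
def RiemannScaling (t : (N : ℕ) → Fin N → D) (V : Submodule ℝ (D → ℝ)) : Prop :=
  ∀ f ∈ V, Tendsto (fun N : ℕ => (1 / (N : ℝ)) * ∑ i, f (t N i) ^ 2) atTop
    (𝓝 (∫ x, f x ^ 2 ∂lebesgueOn D))

open Classical in
/-- The white noise covariance function `δ_{st}`. -/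
def whiteNoise (s t : D) : ℝ := if s = t then 1 else 0

/-- The law `𝒩(m_N, Σ)` of a Gaussian process with mean function `m` and covariance function `k₀`,
observed at the points `t₁, …, t_N`: `m_N = (m(tᵢ))ᵢ` and `Σ = (k₀(tᵢ, tⱼ))ᵢⱼ`. -/
def discretisedGP {N : ℕ} (m : D → ℝ) (k₀ : D → D → ℝ) (t : Fin N → D) :
    Measure (EuclideanSpace ℝ (Fin N)) :=
  multivariateGaussian (WithLp.toLp 2 fun i => m (t i)) (Matrix.of fun i j => k₀ (t i) (t j))

/-- The signal-to-noise ratio of the mean-shift problem `𝒢𝒫(0, k₀)` against `𝒢𝒫(m, k₀)`, observed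
at the `N` points `t`, for the Gauss kernel of bandwidth `γ` on `ℝᴺ`. -/
def meanShiftRatio {N : ℕ} (m : D → ℝ) (k₀ : D → D → ℝ) (t : Fin N → D) (γ : ℝ) : ℝ :=
  signalToNoise (gaussKernel γ) (discretisedGP 0 k₀ t) (discretisedGP m k₀ t)

end Mesh

end KernelTest

end

/-!
The bandwidth `γ_N` grows faster than the typical distance, of order `√N`, of two observations, so
the Gauss kernel only acts through its linear part. With `l = 1 / (2 γ_N²)`,
`k(x, y) = exp(-l ‖x - y‖²)`, and replacing each term of `h` by a linear function of the squared
distance turns `h(z, z')` into a constant plus `2 l ⟪x - y, x' - y'⟫`. For `z = (x, y)` and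
`z' = (x', y')` the differences `x - y` and `x' - y'` are independent `𝒩(-m_N, 2 Σ)` variables, so
that the inner product has mean `‖m_N‖²` and variance `4 σ²` with `σ² = ‖Σ‖_F² + m_Nᵀ Σ m_N`
(`integral_inner_multivariateGaussian`, `pairLaw_inner`; `σ²` is called `shiftVar`). The squared
maximum mean discrepancy is `E h`, by the Riesz representation theorem
(`mmd_sq_eq_integral_integral`). Hence the ratio is about
`2 l ‖m_N‖² / (4 l σ) = ‖m_N‖² / (2 σ)`.

The point is that the linearisation error has to be small compared to the standard deviation `l σ`,
which can be much smaller than the size `l T`, `T = tr Σ + ‖m_N‖²`, of the exponents. For the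
variance, each exponential is therefore linearised around the mean of its exponent, still with slope
`-1`: by `abs_exp_neg_sub_le` the error is at most quadratic in the fluctuation plus `l T` times the
fluctuation. Fluctuations of `‖u‖²` for a Gaussian vector `u` have second and fourth moments
controlled by `σ²` and `σ⁴` independently of the dimension (`exists_norm_sq_moments`), as one sees
in an eigenbasis of the covariance matrix, where `‖u‖²` is a sum of independent squares. This gives
the non-asymptotic estimates `|MMD² - 2 l ‖m_N‖²| ≤ C (l T)²` and `|√ξ₂ - 4 l σ| ≤ C l T · l σ`
(`exists_mmd_xi₂_bounds`). As `T` is of order `N`, as is `‖m_N‖²`, and `l T → 0` because of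
`α > 1/2`, the ratio is asymptotic to `‖m_N‖² / (2 σ)` (`tendsto_meanShiftRatio_div`).

It remains to find the limits of `‖m_N‖² / N`, which is `‖m‖²` by the Riemann scaling property, and
of `σ²`. For white noise `σ² = N + ‖m_N‖²`. For a continuous `k₀`, `σ² / N²` is a double Riemann sum
for `∬ k₀² + ∬ m(x) m(y) k₀(x, y)`. The Riemann scaling property yields its convergence for tensor
products, after polarisation, and these span a dense subspace by the Stone-Weierstrass theorem
(`RiemannScaling.tendsto_doubleSum`). Finally `∬ k₀² = ‖C_{k₀}‖²_HS` by Parseval's identity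
(`hilbertSchmidtNorm_covarianceOperator_sq`), and the second integral is
`⟪m, C_{k₀} m⟫ = ‖C_{k₀}^{1/2} m‖²`. The square root exists because `C_{k₀}` is positive
(`isPositive_covarianceOperator`); it is obtained from an iteration in the operator norm
(`exists_positive_sqrt`).
-/

namespace KernelTest

/-! ### The squared maximum mean discrepancy is the mean of `h` -/

section MMD

variable {X : Type*} {k : X → X → ℝ}

theorem norm_kernelMatrix (x y : X) : ‖kernelMatrix k x y‖ = |k x y| := by
  simp [kernelMatrix, norm_smul]

variable [Fact (kernelMatrix k).PosSemidef]

theorem kerFun_one_apply (x y : X) :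
    RKHS.kerFun (RKHS.OfKernel (kernelMatrix k)) x 1 y = k y x := by
  rw [RKHS.kerFun_apply, RKHS.OfKernel.kernel_ofKernel]
  simp [kernelMatrix]

theorem inner_kerFun_one (x : X) (f : RKHS.OfKernel (kernelMatrix k)) :
    inner ℝ (RKHS.kerFun (RKHS.OfKernel (kernelMatrix k)) x 1) f = f x := by
  rw [RKHS.kerFun_inner]; simp

theorem abs_rkhs_apply_le (hk : ∀ x, k x x = 1) (f : RKHS.OfKernel (kernelMatrix k)) (x : X) :
    |f x| ≤ ‖f‖ := by
  have h := RKHS.norm_apply_le f x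
  rw [RKHS.OfKernel.kernel_ofKernel, norm_kernelMatrix, hk] at h
  simpa using h

/-- `mmd_k(P, Q)² = E[h(z, z')]`, for a normalised bounded kernel whose feature functions are
measurable: the functional `f ↦ ∫ f dP - ∫ f dQ` is bounded on the reproducing kernel Hilbert space,
and its Riesz representative is the difference of the mean embeddings. -/
theorem mmd_sq_eq_integral_integral [MeasurableSpace X] {P Q : Measure X} [IsProbabilityMeasure P]
    [IsProbabilityMeasure Q] (hk : ∀ x, k x x = 1)
    (hmeas : ∀ f : RKHS.OfKernel (kernelMatrix k), Measurable f) :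
    mmd k P Q ^ 2 = (∫ x, ((∫ y, k y x ∂P) - ∫ y, k y x ∂Q) ∂P)
      - ∫ x, ((∫ y, k y x ∂P) - ∫ y, k y x ∂Q) ∂Q := by
  have hint : ∀ (μ : Measure X) [IsProbabilityMeasure μ] (f : RKHS.OfKernel (kernelMatrix k)),
      Integrable f μ := fun μ _ f =>
    Integrable.of_bound (C := ‖f‖) (hmeas f).aestronglyMeasurable
      (ae_of_all _ fun x => (Real.norm_eq_abs _).trans_le (abs_rkhs_apply_le hk f x))
  have hbd : ∀ (μ : Measure X) [IsProbabilityMeasure μ] (f : RKHS.OfKernel (kernelMatrix k)),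
      |∫ x, f x ∂μ| ≤ ‖f‖ := by
    intro μ _ f
    refine (norm_integral_le_of_norm_le_const (C := ‖f‖)
      (ae_of_all μ fun x => (Real.norm_eq_abs _).trans_le (abs_rkhs_apply_le hk f x))).trans ?_
    simp
  let L : RKHS.OfKernel (kernelMatrix k) →L[ℝ] ℝ := LinearMap.mkContinuous
    { toFun := fun f => (∫ x, f x ∂P) - ∫ x, f x ∂Q
      map_add' := fun f g => by
        simp only [RKHS.coe_add, Pi.add_apply]
        rw [integral_add (hint P f) (hint P g), integral_add (hint Q f) (hint Q g)]
        ring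
      map_smul' := fun c f => by
        simp only [RKHS.coe_smul, Pi.smul_apply, smul_eq_mul, integral_const_mul,
          RingHom.id_apply]
        ring } 2 fun f => by
      have h1 := hbd P f
      have h2 := hbd Q f
      refine (abs_sub _ _).trans ?_
      linarith
  have hL : ∀ f, L f = (∫ x, f x ∂P) - ∫ x, f x ∂Q := fun f => rfl
  have hmmd : mmd k P Q = ‖L‖ := by
    rw [← L.sSup_unitClosedBall_eq_norm, mmd, iSup]
    congr 1
    ext r
    simp only [Set.mem_range, Subtype.exists, Set.mem_image, Metric.mem_closedBall,
      dist_zero_right]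
    constructor
    · rintro ⟨f, hf, rfl⟩; exact ⟨f, hf, rfl⟩
    · rintro ⟨f, hf, rfl⟩; exact ⟨f, hf, rfl⟩
  -- the Riesz representative of `L`, which realises its norm: `‖L‖² = L g`
  set g : RKHS.OfKernel (kernelMatrix k) := (InnerProductSpace.toDual ℝ _).symm L
  have hg : ∀ f, inner ℝ g f = L f := fun f => InnerProductSpace.toDual_symm_apply
  have hgx : ∀ x, g x = (∫ y, k y x ∂P) - ∫ y, k y x ∂Q := by
    intro x
    rw [← inner_kerFun_one, real_inner_comm, hg, hL]
    simp_rw [kerFun_one_apply]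
  have hnorm : ‖L‖ ^ 2 = L g := by
    rw [← hg, real_inner_self_eq_norm_sq, LinearIsometryEquiv.norm_map]
  rw [hmmd, hnorm, hL]
  simp_rw [hgx]

/-- Elements of the reproducing kernel Hilbert space of a continuous normalised kernel are
continuous, as `|f x - f y|² ≤ ‖f‖² (2 - 2 k(x, y))`. -/
theorem continuous_rkhs [TopologicalSpace X] (hk : ∀ x, k x x = 1)
    (hc : Continuous (Function.uncurry k)) (f : RKHS.OfKernel (kernelMatrix k)) :
    Continuous f := by
  have hsymm : ∀ x y, k x y = k y x := by
    intro x y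
    rw [← kerFun_one_apply (k := k) y x, ← inner_kerFun_one, real_inner_comm, inner_kerFun_one,
      kerFun_one_apply]
  have hdist : ∀ x y, |f x - f y| ≤ ‖f‖ * √(2 - 2 * k x y) := by
    intro x y
    rw [← inner_kerFun_one x f, ← inner_kerFun_one y f, ← inner_sub_left]
    refine (abs_real_inner_le_norm _ _).trans ?_
    rw [mul_comm]
    refine mul_le_mul_of_nonneg_left ?_ (norm_nonneg _)
    refine Real.le_sqrt_of_sq_le ?_
    rw [norm_sub_sq_real, ← real_inner_self_eq_norm_sq, ← real_inner_self_eq_norm_sq,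
      inner_kerFun_one, inner_kerFun_one, inner_kerFun_one, kerFun_one_apply, kerFun_one_apply,
      kerFun_one_apply, hk, hk]
    linarith
  rw [continuous_iff_continuousAt]
  intro x
  rw [ContinuousAt, tendsto_iff_dist_tendsto_zero]
  have h0 : Tendsto (fun y => ‖f‖ * √(2 - 2 * k y x)) (𝓝 x) (𝓝 0) := by
    have hcy : Continuous fun y => ‖f‖ * √(2 - 2 * k y x) := by
      have : Continuous fun y => k y x := hc.comp (by fun_prop : Continuous fun y => (y, x))
      fun_prop
    have := hcy.tendsto x
    simpa [hk] using this
  exact squeeze_zero (fun y => dist_nonneg) (fun y => hdist y x) h0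

end MMD

section GaussKernel

variable {E : Type*} [NormedAddCommGroup E]

theorem gaussKernel_self (γ : ℝ) (x : E) : gaussKernel γ x x = 1 := by
  simp [gaussKernel]

theorem gaussKernel_comm (γ : ℝ) (x y : E) : gaussKernel γ x y = gaussKernel γ y x := by
  simp [gaussKernel, norm_sub_rev]

theorem continuous_gaussKernel (γ : ℝ) :
    Continuous (Function.uncurry (gaussKernel γ : E → E → ℝ)) := by
  unfold gaussKernel Function.uncurry
  fun_prop

theorem gaussKernel_nonneg (γ : ℝ) (x y : E) : 0 ≤ gaussKernel γ x y := (Real.exp_pos _).le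

theorem gaussKernel_le_one (γ : ℝ) (x y : E) : gaussKernel γ x y ≤ 1 := by
  rw [gaussKernel, Real.exp_le_one_iff]
  have : 0 ≤ (1 / 2) * (γ ^ 2)⁻¹ * ‖x - y‖ ^ 2 := by positivity
  linarith

end GaussKernel

/-- `mmd_k(P, Q)² = E[h(z, z')]` for the Gauss kernel, with the four terms of `h` collected under
one integral. -/
theorem mmd_gaussKernel_sq {N : ℕ} (γ : ℝ) (P Q : Measure (EuclideanSpace ℝ (Fin N)))
    [IsProbabilityMeasure P] [IsProbabilityMeasure Q] :
    mmd (gaussKernel γ) P Q ^ 2 =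
      ∫ w : (EuclideanSpace ℝ (Fin N) × EuclideanSpace ℝ (Fin N)) ×
          (EuclideanSpace ℝ (Fin N) × EuclideanSpace ℝ (Fin N)),
        hCore (gaussKernel γ) w.1 w.2 ∂((P.prod Q).prod (P.prod Q)) := by
  set E := EuclideanSpace ℝ (Fin N)
  set k : E → E → ℝ := gaussKernel γ
  have hkc : Continuous (Function.uncurry k) := continuous_gaussKernel γ
  have hint : ∀ {Y : Type} [MeasurableSpace Y] (μ : Measure Y) [IsProbabilityMeasure μ]
      (f g : Y → E), Measurable f → Measurable g → Integrable (fun y => k (f y) (g y)) μ := by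
    intro Y _ μ _ f g hf hg
    refine Integrable.of_bound (C := 1)
      (hkc.measurable.comp (hf.prodMk hg)).aestronglyMeasurable (ae_of_all _ fun y => ?_)
    rw [Real.norm_of_nonneg (gaussKernel_nonneg _ _ _)]
    exact gaussKernel_le_one _ _ _
  have hpair : ∀ (μ ν : Measure E) [IsProbabilityMeasure μ] [IsProbabilityMeasure ν],
      ∫ x, ∫ y, k y x ∂μ ∂ν = ∫ p, k p.1 p.2 ∂(μ.prod ν) := by
    intro μ ν _ _
    rw [integral_prod_symm _ (hint _ _ _ measurable_fst measurable_snd)]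
  have hinner : ∀ (μ ν : Measure E) [IsProbabilityMeasure μ] [IsProbabilityMeasure ν],
      Integrable (fun x => ∫ y, k y x ∂μ) ν := by
    intro μ ν _ _
    exact (hint (μ.prod ν) _ _ measurable_fst measurable_snd).integral_prod_right
  have hpp : ∀ (f g : E × E → E) (μ ν : Measure E) [IsProbabilityMeasure μ]
      [IsProbabilityMeasure ν], MeasurePreserving f (P.prod Q) μ → MeasurePreserving g (P.prod Q) ν →
      ∫ w, k (f w.1) (g w.2) ∂((P.prod Q).prod (P.prod Q)) = ∫ p, k p.1 p.2 ∂(μ.prod ν) := by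
    intro f g μ ν _ _ hf hg
    rw [← (hf.prod hg).map_eq, integral_map (hf.prod hg).measurable.aemeasurable]
    · rfl
    · exact hkc.measurable.aestronglyMeasurable
  have h1 : MeasurePreserving Prod.fst (P.prod Q) P := measurePreserving_fst
  have h2 : MeasurePreserving Prod.snd (P.prod Q) Q := measurePreserving_snd
  rw [mmd_sq_eq_integral_integral (gaussKernel_self γ)
    fun f => (continuous_rkhs (gaussKernel_self γ) hkc f).measurable]
  rw [integral_sub (hinner _ _) (hinner _ _), integral_sub (hinner _ _) (hinner _ _),
    hpair, hpair, hpair, hpair]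
  unfold hCore
  have e1 : ∫ w : (E × E) × (E × E), k w.2.1 w.1.2 ∂((P.prod Q).prod (P.prod Q))
      = ∫ p, k p.1 p.2 ∂(Q.prod P) := by
    rw [← hpp _ _ Q P h2 h1]
    exact integral_congr_ae (ae_of_all _ fun w => gaussKernel_comm _ _ _)
  rw [integral_sub, integral_sub, integral_add]
  · rw [e1, hpp _ _ _ _ h1 h1, hpp _ _ _ _ h2 h2, hpp _ _ _ _ h1 h2]
    ring
  all_goals
    first
    | exact hint _ _ _ (by fun_prop) (by fun_prop)
    | exact (hint _ _ _ (by fun_prop) (by fun_prop)).add (hint _ _ _ (by fun_prop) (by fun_prop))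
    | exact ((hint _ _ _ (by fun_prop) (by fun_prop)).add
        (hint _ _ _ (by fun_prop) (by fun_prop))).sub (hint _ _ _ (by fun_prop) (by fun_prop))

/-! ### Random variables with finite moments -/

/-- All absolute moments of the random variable `f` are finite. -/
def HasMoments {Ω : Type*} [MeasurableSpace Ω] (f : Ω → ℝ) (μ : Measure Ω) : Prop :=
  ∀ p : ℕ, MemLp f p μ

namespace HasMoments

variable {Ω : Type*} [MeasurableSpace Ω] {μ : Measure Ω} {f g : Ω → ℝ}

theorem add (hf : HasMoments f μ) (hg : HasMoments g μ) : HasMoments (fun x => f x + g x) μ :=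
  fun p => (hf p).add (hg p)

theorem sub (hf : HasMoments f μ) (hg : HasMoments g μ) : HasMoments (fun x => f x - g x) μ :=
  fun p => (hf p).sub (hg p)

theorem mul (hf : HasMoments f μ) (hg : HasMoments g μ) : HasMoments (fun x => f x * g x) μ := by
  intro p
  have : ENNReal.HolderTriple ((2 * p : ℕ) : ENNReal) ((2 * p : ℕ) : ENNReal) (p : ENNReal) := by
    refine ⟨?_⟩
    push_cast
    rw [ENNReal.mul_inv (by simp) (by simp), ← add_mul, ENNReal.inv_two_add_inv_two, one_mul]
  exact (hg (2 * p)).mul (hf (2 * p))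

theorem const_mul (hf : HasMoments f μ) (c : ℝ) : HasMoments (fun x => c * f x) μ :=
  fun p => (hf p).const_mul c

theorem const [IsFiniteMeasure μ] (c : ℝ) : HasMoments (fun _ : Ω => c) μ :=
  fun _ => memLp_const c

theorem pow [IsFiniteMeasure μ] (hf : HasMoments f μ) (n : ℕ) :
    HasMoments (fun x => f x ^ n) μ := by
  induction n with
  | zero => simpa using const 1
  | succ n ih => simpa only [pow_succ] using ih.mul hf

theorem sum {ι : Type*} {F : ι → Ω → ℝ} (s : Finset ι) (hF : ∀ i ∈ s, HasMoments (F i) μ) :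
    HasMoments (fun x => ∑ i ∈ s, F i x) μ :=
  fun p => memLp_finsetSum s fun i hi => hF i hi p

theorem abs (hf : HasMoments f μ) : HasMoments (fun x => |f x|) μ :=
  fun p => (hf p).norm

theorem integrable (hf : HasMoments f μ) : Integrable f μ := by
  have h := hf 1
  rwa [Nat.cast_one, memLp_one_iff_integrable] at h

theorem memLp_two (hf : HasMoments f μ) : MemLp f 2 μ := by exact_mod_cast hf 2

theorem aestronglyMeasurable (hf : HasMoments f μ) : AEStronglyMeasurable f μ := (hf 0).1

theorem comp {Ω' : Type*} [MeasurableSpace Ω'] {ν : Measure Ω'} {φ : Ω' → Ω}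
    (hf : HasMoments f μ) (hφ : MeasurePreserving φ ν μ) : HasMoments (fun x => f (φ x)) ν :=
  fun p => (hf p).comp_measurePreserving hφ

theorem of_bound [IsFiniteMeasure μ] (hf : AEStronglyMeasurable f μ) (C : ℝ)
    (h : ∀ x, |f x| ≤ C) : HasMoments f μ :=
  fun _ => MemLp.of_bound hf C (ae_of_all _ h)

end HasMoments

/-- Induction step for `integral_sum_pow_le_of_iIndepFun`. The factor `3` is what makes the bound
on the fourth moment stable under sums, because of the cross term `6 E[S²] E[X²]`. -/
theorem integral_add_sq_le_of_indepFun {Ω : Type*} [MeasurableSpace Ω] {μ : Measure Ω}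
    [IsProbabilityMeasure μ] {S X : Ω → ℝ} (hS : HasMoments S μ) (hX : HasMoments X μ)
    (hind : IndepFun S X μ) (hS0 : ∫ x, S x ∂μ = 0) (hX0 : ∫ x, X x ∂μ = 0) {s v : ℝ}
    (hS2 : ∫ x, S x ^ 2 ∂μ ≤ s) (hX2 : ∫ x, X x ^ 2 ∂μ ≤ v)
    (hS4 : ∫ x, S x ^ 4 ∂μ ≤ 3 * s ^ 2) (hX4 : ∫ x, X x ^ 4 ∂μ ≤ 3 * v ^ 2) :
    ∫ x, (S x + X x) ∂μ = 0 ∧ ∫ x, (S x + X x) ^ 2 ∂μ ≤ s + v ∧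
      ∫ x, (S x + X x) ^ 4 ∂μ ≤ 3 * (s + v) ^ 2 := by
  have hprod : ∀ a b : ℕ, ∫ x, S x ^ a * X x ^ b ∂μ = (∫ x, S x ^ a ∂μ) * ∫ x, X x ^ b ∂μ := by
    intro a b
    have h : IndepFun (fun x => S x ^ a) (fun x => X x ^ b) μ :=
      hind.comp (φ := fun y => y ^ a) (ψ := fun y => y ^ b) (by fun_prop) (by fun_prop)
    exact h.integral_fun_mul_eq_mul_integral (hS.pow a).aestronglyMeasurable
      (hX.pow b).aestronglyMeasurable
  have hi : ∀ (a b : ℕ), Integrable (fun x => S x ^ a * X x ^ b) μ := fun a b =>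
    ((hS.pow a).mul (hX.pow b)).integrable
  have hp11 := hprod 1 1
  have hp31 := hprod 3 1
  have hp13 := hprod 1 3
  have hp22 := hprod 2 2
  simp only [pow_one, hS0, hX0, mul_zero, zero_mul] at hp11 hp31 hp13
  have hs0 : 0 ≤ ∫ x, S x ^ 2 ∂μ := integral_nonneg fun x => sq_nonneg _
  have hv0 : 0 ≤ ∫ x, X x ^ 2 ∂μ := integral_nonneg fun x => sq_nonneg _
  refine ⟨?_, ?_, ?_⟩
  · rw [integral_add hS.integrable hX.integrable, hS0, hX0, add_zero]
  · have e : ∀ x, (S x + X x) ^ 2 = S x ^ 2 + 2 * (S x * X x) + X x ^ 2 := fun x => by ring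
    simp_rw [e]
    rw [integral_add, integral_add, integral_const_mul, hp11]
    · linarith
    · exact (hS.pow 2).integrable
    · exact ((hS.mul hX).const_mul 2).integrable
    · exact ((hS.pow 2).add ((hS.mul hX).const_mul 2)).integrable
    · exact (hX.pow 2).integrable
  · have e : ∀ x, (S x + X x) ^ 4 = S x ^ 4 + 4 * (S x ^ 3 * X x) + 6 * (S x ^ 2 * X x ^ 2)
        + 4 * (S x * X x ^ 3) + X x ^ 4 := fun x => by ring
    have i1 := hS.pow 4
    have i2 := ((hS.pow 3).mul hX).const_mul 4
    have i3 := ((hS.pow 2).mul (hX.pow 2)).const_mul 6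
    have i4 := (hS.mul (hX.pow 3)).const_mul 4
    have i5 := hX.pow 4
    simp_rw [e]
    rw [integral_add (((i1.add i2).add i3).add i4).integrable i5.integrable,
      integral_add ((i1.add i2).add i3).integrable i4.integrable,
      integral_add (i1.add i2).integrable i3.integrable,
      integral_add i1.integrable i2.integrable, integral_const_mul, integral_const_mul,
      integral_const_mul, hp31, hp13, hp22]
    have := mul_le_mul hS2 hX2 hv0 (hs0.trans hS2)
    nlinarith

/-- A sum of independent centred random variables whose fourth moments are controlled by the squares
of the bounds `vᵢ` for their variances has a fourth moment controlled by `(∑ vᵢ)²`. -/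
theorem integral_sum_pow_le_of_iIndepFun {Ω ι : Type*} [MeasurableSpace Ω] {μ : Measure Ω}
    [IsProbabilityMeasure μ] {X : ι → Ω → ℝ} (hX : ∀ i, HasMoments (X i) μ)
    (hmeas : ∀ i, Measurable (X i)) (hind : iIndepFun X μ) (h0 : ∀ i, ∫ x, X i x ∂μ = 0)
    {v : ι → ℝ} (h2 : ∀ i, ∫ x, X i x ^ 2 ∂μ ≤ v i)
    (h4 : ∀ i, ∫ x, X i x ^ 4 ∂μ ≤ 3 * v i ^ 2) (s : Finset ι) :
    ∫ x, (∑ i ∈ s, X i x) ∂μ = 0 ∧ ∫ x, (∑ i ∈ s, X i x) ^ 2 ∂μ ≤ ∑ i ∈ s, v i ∧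
      ∫ x, (∑ i ∈ s, X i x) ^ 4 ∂μ ≤ 3 * (∑ i ∈ s, v i) ^ 2 := by
  classical
  induction s using Finset.induction_on with
  | empty => simp
  | insert i s hi ih =>
    have hI := hind.indepFun_finsetSum_of_notMem hmeas hi
    have e : (∑ j ∈ s, X j) = fun x => ∑ j ∈ s, X j x := by ext x; simp
    rw [e] at hI
    have := integral_add_sq_le_of_indepFun (HasMoments.sum s fun j _ => hX j) (hX i) hI ih.1 (h0 i)
      ih.2.1 (h2 i) ih.2.2 (h4 i)
    simp_rw [Finset.sum_insert hi, add_comm (X i _), add_comm (v i)]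
    exact this

/-! ### Squared Gaussian variables -/

theorem hasMoments_gaussianReal (a : ℝ) (v : NNReal) :
    HasMoments (fun x => x) (gaussianReal a v) :=
  fun p => memLp_id_gaussianReal' p (by simp)

theorem gaussianReal_eq_map (a : ℝ) (v : NNReal) :
    gaussianReal a v = (gaussianReal 0 1).map fun g => a + √v * g := by
  have : (fun g : ℝ => a + √v * g) = (fun g => a + g) ∘ fun g => √v * g := rfl
  rw [this, ← Measure.map_map (by fun_prop) (by fun_prop), gaussianReal_map_const_mul,
    gaussianReal_map_const_add]
  congr 1
  · simp
  · ext; simp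

theorem integral_sq_stdGaussianReal : ∫ g, g ^ 2 ∂gaussianReal 0 1 = 1 := by
  have h := variance_fun_id_gaussianReal (μ := 0) (v := 1)
  rw [variance_of_integral_eq_zero (by fun_prop) (by simp)] at h
  simpa using h

/-- The centred square of a Gaussian variable `a + √v g` is `v (g² - 1) + 2 a √v g`, whose second
and fourth moments are of the order of `v² + v a²` and its square. -/
theorem exists_gaussianReal_sq_moments : ∃ C : ℝ, 1 ≤ C ∧ ∀ (a : ℝ) (v : NNReal),
    ∫ x, (x ^ 2 - (a ^ 2 + v)) ∂gaussianReal a v = 0 ∧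
    ∫ x, (x ^ 2 - (a ^ 2 + v)) ^ 2 ∂gaussianReal a v ≤ C * (v ^ 2 + v * a ^ 2) ∧
    ∫ x, (x ^ 2 - (a ^ 2 + v)) ^ 4 ∂gaussianReal a v ≤ 3 * (C * (v ^ 2 + v * a ^ 2)) ^ 2 := by
  set G := gaussianReal 0 1
  have hg : HasMoments (fun x => x) G := hasMoments_gaussianReal 0 1
  have hq : HasMoments (fun x => x ^ 2 - 1) G := (hg.pow 2).sub (HasMoments.const 1)
  set A := ∫ g, (g ^ 2 - 1) ^ 2 ∂G
  set B := ∫ g, (g ^ 2 - 1) ^ 4 ∂G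
  set F := ∫ g, g ^ 4 ∂G
  have hA : 0 ≤ A := integral_nonneg fun g => by positivity
  have hB : 0 ≤ B := integral_nonneg fun g => by positivity
  have hF : 0 ≤ F := integral_nonneg fun g => by positivity
  -- `2 A` and `8` bound the second moment, `8 B` and `128 F` the fourth; as `C ≥ 1`, `C ≤ 3 C²`
  refine ⟨1 + 2 * A + 8 + 8 * B + 128 * F, by linarith, fun a v => ?_⟩
  set C := 1 + 2 * A + 8 + 8 * B + 128 * F
  have hmap : ∀ f : ℝ → ℝ, Continuous f →
      ∫ x, f x ∂gaussianReal a v = ∫ g, f (a + √v * g) ∂G := by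
    intro f hf
    rw [gaussianReal_eq_map, integral_map (by fun_prop) hf.aestronglyMeasurable]
  have hsq : √(v : ℝ) ^ 2 = v := Real.sq_sqrt v.2
  have e : ∀ g : ℝ, (a + √v * g) ^ 2 - (a ^ 2 + v) = v * (g ^ 2 - 1) + 2 * a * √v * g := by
    intro g
    linear_combination g ^ 2 * hsq
  have hv : (0 : ℝ) ≤ v := v.2
  rw [hmap _ (by fun_prop), hmap _ (by fun_prop), hmap _ (by fun_prop)]
  simp_rw [e]
  have hY := (hq.const_mul (v : ℝ)).add (hg.const_mul (2 * a * √v))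
  refine ⟨?_, ?_, ?_⟩
  · rw [integral_add (hq.const_mul _).integrable (hg.const_mul _).integrable, integral_const_mul,
      integral_const_mul, integral_sub (hg.pow 2).integrable (integrable_const _),
      integral_sq_stdGaussianReal]
    simp [G]
  · have hle : ∀ g : ℝ, (v * (g ^ 2 - 1) + 2 * a * √v * g) ^ 2 ≤
        2 * v ^ 2 * (g ^ 2 - 1) ^ 2 + 8 * (v * a ^ 2) * g ^ 2 := by
      intro g
      have h := sq_nonneg (v * (g ^ 2 - 1) - 2 * a * √v * g)
      have h2 : (2 * a * √v * g) ^ 2 = 4 * (v * a ^ 2) * g ^ 2 := by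
        rw [mul_pow, mul_pow, mul_pow, hsq]; ring
      nlinarith
    refine (integral_mono (hY.pow 2).integrable
      ((((hq.pow 2).const_mul _).add ((hg.pow 2).const_mul _))).integrable hle).trans ?_
    rw [integral_add ((hq.pow 2).const_mul _).integrable ((hg.pow 2).const_mul _).integrable,
      integral_const_mul, integral_const_mul, integral_sq_stdGaussianReal]
    have h1 : 0 ≤ (v : ℝ) ^ 2 := by positivity
    have h2 : 0 ≤ (v : ℝ) * a ^ 2 := by positivity
    have c1 : 2 * A ≤ C := by simp only [C]; linarith
    have c2 : 8 ≤ C := by simp only [C]; linarith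
    nlinarith [mul_le_mul_of_nonneg_right c1 h1, mul_le_mul_of_nonneg_right c2 h2]
  · have hle : ∀ g : ℝ, (v * (g ^ 2 - 1) + 2 * a * √v * g) ^ 4 ≤
        8 * v ^ 4 * (g ^ 2 - 1) ^ 4 + 128 * (v * a ^ 2) ^ 2 * g ^ 4 := by
      intro g
      set p := v * (g ^ 2 - 1)
      set q := 2 * a * √v * g
      have hq4 : q ^ 4 = 16 * (v * a ^ 2) ^ 2 * g ^ 4 := by
        have : q ^ 2 = 4 * (v * a ^ 2) * g ^ 2 := by
          simp only [q]
          rw [mul_pow, mul_pow, mul_pow, hsq]; ring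
        calc q ^ 4 = (q ^ 2) ^ 2 := by ring
          _ = _ := by rw [this]; ring
      have hp4 : p ^ 4 = v ^ 4 * (g ^ 2 - 1) ^ 4 := by simp only [p]; ring
      have h1 : (p + q) ^ 2 ≤ 2 * (p ^ 2 + q ^ 2) := by nlinarith [sq_nonneg (p - q)]
      have h2 : (p + q) ^ 4 ≤ (2 * (p ^ 2 + q ^ 2)) ^ 2 := by
        calc (p + q) ^ 4 = ((p + q) ^ 2) ^ 2 := by ring
          _ ≤ _ := pow_le_pow_left₀ (sq_nonneg _) h1 2
      nlinarith [sq_nonneg (p ^ 2 - q ^ 2)]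
    refine (integral_mono (hY.pow 4).integrable
      ((((hq.pow 4).const_mul _).add ((hg.pow 4).const_mul _))).integrable hle).trans ?_
    rw [integral_add ((hq.pow 4).const_mul _).integrable ((hg.pow 4).const_mul _).integrable,
      integral_const_mul, integral_const_mul]
    set w := (v : ℝ) * a ^ 2
    have hw : 0 ≤ w := by positivity
    have c1 : 8 * B ≤ C := by simp only [C]; linarith
    have c2 : 128 * F ≤ C := by simp only [C]; linarith
    have c3 : 1 ≤ C := by simp only [C]; linarith
    calc 8 * (v : ℝ) ^ 4 * B + 128 * w ^ 2 * F
        = (8 * B) * (v : ℝ) ^ 4 + (128 * F) * w ^ 2 := by ring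
      _ ≤ C * (v : ℝ) ^ 4 + C * w ^ 2 := by gcongr
      _ = C * (((v : ℝ) ^ 2) ^ 2 + w ^ 2) := by ring
      _ ≤ C * (v ^ 2 + w) ^ 2 := by
          gcongr
          nlinarith [mul_nonneg (sq_nonneg (v : ℝ)) hw]
      _ ≤ 3 * C ^ 2 * (v ^ 2 + w) ^ 2 := by
          gcongr
          nlinarith
      _ = 3 * (C * (v ^ 2 + w)) ^ 2 := by ring

/-! ### Multivariate Gaussian variables -/

section MultivariateGaussian

variable {N : ℕ} {A : Matrix (Fin N) (Fin N) ℝ}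

theorem hasMoments_coord (a : EuclideanSpace ℝ (Fin N)) (i : Fin N) :
    HasMoments (fun x : EuclideanSpace ℝ (Fin N) => x i) (multivariateGaussian a A) := by
  intro p
  have h := (EuclideanSpace.proj i : EuclideanSpace ℝ (Fin N) →L[ℝ] ℝ).comp_memLp'
    (IsGaussian.memLp_id (multivariateGaussian a A) p (by simp))
  simpa using h

theorem hasMoments_norm_sq (a : EuclideanSpace ℝ (Fin N)) :
    HasMoments (fun x : EuclideanSpace ℝ (Fin N) => ‖x‖ ^ 2) (multivariateGaussian a A) := by
  simp_rw [EuclideanSpace.real_norm_sq_eq]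
  exact HasMoments.sum _ fun i _ => (hasMoments_coord a i).pow 2

theorem integral_coord (a : EuclideanSpace ℝ (Fin N)) (i : Fin N) :
    ∫ x, x i ∂multivariateGaussian a A = a i := by
  have h := (EuclideanSpace.proj i : EuclideanSpace ℝ (Fin N) →L[ℝ] ℝ).integral_comp_id_comm
    (IsGaussian.integrable_id (μ := multivariateGaussian a A))
  simpa using h

theorem integral_coord_mul_coord (hA : A.PosSemidef) (a : EuclideanSpace ℝ (Fin N)) (i j : Fin N) :
    ∫ x, x i * x j ∂multivariateGaussian a A = a i * a j + A i j := by
  have h := covariance_eq_sub (hasMoments_coord (A := A) a i).memLp_two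
    (hasMoments_coord (A := A) a j).memLp_two
  rw [covariance_eval_multivariateGaussian hA, integral_coord, integral_coord] at h
  simp only [Pi.mul_apply] at h
  linarith

/-- The difference of independent `𝒩(a, A)` and `𝒩(b, A)` variables has law `𝒩(a - b, 2 A)`. -/
theorem map_sub_multivariateGaussian (hA : A.PosSemidef) (a b : EuclideanSpace ℝ (Fin N)) :
    ((multivariateGaussian a A).prod (multivariateGaussian b A)).map (fun p => p.1 - p.2) =
      multivariateGaussian (a - b) ((2 : ℝ) • A) := by
  have h2A : ((2 : ℝ) • A).PosSemidef := hA.smul (by norm_num)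
  have : IsProbabilityMeasure (((multivariateGaussian a A).prod (multivariateGaussian b A)).map
      fun p => p.1 - p.2) := Measure.isProbabilityMeasure_map (by fun_prop)
  refine Measure.ext_of_charFun ?_
  ext t
  rw [charFun_multivariateGaussian h2A, charFun_apply, integral_map (by fun_prop) (by fun_prop)]
  have e : ∀ p : EuclideanSpace ℝ (Fin N) × EuclideanSpace ℝ (Fin N),
      Complex.exp ((inner ℝ (p.1 - p.2) t : ℝ) * Complex.I) =
        Complex.exp ((inner ℝ p.1 t : ℝ) * Complex.I) *
          Complex.exp ((inner ℝ p.2 (-t) : ℝ) * Complex.I) := by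
    intro p
    rw [← Complex.exp_add, inner_sub_left, inner_neg_right]
    congr 1
    push_cast
    ring
  simp_rw [e]
  rw [integral_prod_mul (fun x => Complex.exp ((inner ℝ x t : ℝ) * Complex.I))
    (fun x => Complex.exp ((inner ℝ x (-t) : ℝ) * Complex.I)), ← charFun_apply, ← charFun_apply,
    charFun_multivariateGaussian hA, charFun_multivariateGaussian hA, ← Complex.exp_add]
  congr 1
  simp only [inner_sub_right, inner_neg_left, WithLp.ofLp_neg, Matrix.mulVec_neg,
    neg_dotProduct_neg, Matrix.smul_mulVec, dotProduct_smul, smul_eq_mul]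
  push_cast
  ring

theorem inner_eigenvectorBasis_mulVec (hA : A.IsHermitian) (x : EuclideanSpace ℝ (Fin N))
    (i : Fin N) :
    inner ℝ (hA.eigenvectorBasis i) (WithLp.toLp 2 (A.mulVec x)) =
      hA.eigenvalues i * inner ℝ (hA.eigenvectorBasis i) x := by
  have hT : A.transpose = A := by simpa using hA.eq
  rw [EuclideanSpace.inner_eq_star_dotProduct, EuclideanSpace.inner_eq_star_dotProduct]
  simp only [star_trivial]
  rw [dotProduct_comm, Matrix.dotProduct_mulVec, ← Matrix.mulVec_transpose, hT,
    hA.mulVec_eigenvectorBasis, smul_dotProduct, smul_eq_mul, dotProduct_comm]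

theorem dotProduct_mulVec_eq_sum_eigenvalues (hA : A.IsHermitian) (x : EuclideanSpace ℝ (Fin N)) :
    x.ofLp ⬝ᵥ A.mulVec x.ofLp =
      ∑ i, hA.eigenvalues i * inner ℝ (hA.eigenvectorBasis i) x ^ 2 := by
  have h : x.ofLp ⬝ᵥ A.mulVec x.ofLp = inner ℝ x (WithLp.toLp 2 (A.mulVec x)) := by
    rw [EuclideanSpace.inner_eq_star_dotProduct]
    simp [dotProduct_comm]
  rw [h, ← hA.eigenvectorBasis.sum_inner_mul_inner]
  refine Finset.sum_congr rfl fun i _ => ?_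
  rw [inner_eigenvectorBasis_mulVec, real_inner_comm]
  ring

theorem sum_sq_eq_sum_eigenvalues_sq (hA : A.IsHermitian) :
    ∑ i, ∑ j, A i j ^ 2 = ∑ i, hA.eigenvalues i ^ 2 := by
  have h1 : ∀ i, hA.eigenvalues i ^ 2 =
      ∑ j, inner ℝ (hA.eigenvectorBasis i) (WithLp.toLp 2 fun k => A k j) ^ 2 := by
    intro i
    have e : ∀ j, inner ℝ (hA.eigenvectorBasis i) (WithLp.toLp 2 fun k => A k j) =
        hA.eigenvalues i * hA.eigenvectorBasis i j := by
      intro j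
      have h := inner_eigenvectorBasis_mulVec hA (EuclideanSpace.single j 1) i
      rw [EuclideanSpace.inner_single_right] at h
      have hcol : A.mulVec (EuclideanSpace.single j (1 : ℝ)).ofLp = fun k => A k j := by
        ext k
        simp
      rw [hcol] at h
      simpa using h
    simp_rw [e, mul_pow]
    rw [← Finset.mul_sum, ← EuclideanSpace.real_norm_sq_eq]
    simp
  rw [Finset.sum_comm, Finset.sum_congr rfl fun i _ => h1 i]
  conv_rhs => rw [Finset.sum_comm]
  refine Finset.sum_congr rfl fun j _ => ?_
  rw [hA.eigenvectorBasis.sum_sq_inner_right, EuclideanSpace.real_norm_sq_eq]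

/-- The coordinates of a Gaussian vector in an eigenbasis of its covariance matrix are
independent Gaussian variables. -/
theorem multivariateGaussian_eq_map_pi (hA : A.PosSemidef) (a : EuclideanSpace ℝ (Fin N)) :
    multivariateGaussian a A =
      (Measure.pi fun i => gaussianReal (inner ℝ (hA.1.eigenvectorBasis i) a)
        (hA.1.eigenvalues i).toNNReal).map fun x => ∑ i, x i • hA.1.eigenvectorBasis i := by
  set b := hA.1.eigenvectorBasis
  have : IsProbabilityMeasure ((Measure.pi fun i => gaussianReal (inner ℝ (b i) a)
      (hA.1.eigenvalues i).toNNReal).map fun x => ∑ i, x i • b i) :=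
    Measure.isProbabilityMeasure_map (Measurable.aemeasurable (by fun_prop))
  refine Measure.ext_of_charFun ?_
  ext t
  rw [charFun_multivariateGaussian hA, charFun_apply,
    integral_map (Measurable.aemeasurable (by fun_prop))
      (Continuous.aestronglyMeasurable (by fun_prop))]
  simp_rw [sum_inner, Complex.ofReal_sum, Finset.sum_mul, Complex.exp_sum]
  rw [integral_fintype_prod_eq_prod
    (f := fun i x => Complex.exp ((inner ℝ (x • b i) t : ℝ) * Complex.I))]
  simp_rw [real_inner_smul_left, mul_comm _ (inner ℝ (b _) t), Complex.ofReal_mul,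
    ← charFun_apply_real, charFun_gaussianReal, ← Complex.exp_sum]
  congr 1
  rw [Finset.sum_sub_distrib, ← Finset.sum_div, ← b.sum_inner_mul_inner t a,
    dotProduct_mulVec_eq_sum_eigenvalues hA.1, ← Finset.sum_mul]
  push_cast
  congr 3
  · ext i
    rw [real_inner_comm]
  · ext i
    have : (((hA.1.eigenvalues i).toNNReal : ℝ) : ℂ) = (hA.1.eigenvalues i : ℂ) := by
      rw [Real.coe_toNNReal _ (hA.eigenvalues_nonneg i)]
    rw [this]

/-- `‖A‖_F² + aᵀ A a`, which is of the order of the variance of `‖x‖²` for `x ∼ 𝒩(a, A)`. -/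
def shiftVar (a : EuclideanSpace ℝ (Fin N)) (A : Matrix (Fin N) (Fin N) ℝ) : ℝ :=
  (∑ i, ∑ j, A i j ^ 2) + a.ofLp ⬝ᵥ A.mulVec a.ofLp

/-- In an eigenbasis of `A`, `shiftVar a A` is the sum of the one-dimensional variance bounds
`v² + v c²` of `exists_gaussianReal_sq_moments`. -/
theorem shiftVar_eq_sum (hA : A.PosSemidef) (a : EuclideanSpace ℝ (Fin N)) :
    shiftVar a A = ∑ i, (hA.1.eigenvalues i ^ 2 +
      hA.1.eigenvalues i * inner ℝ (hA.1.eigenvectorBasis i) a ^ 2) := by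
  rw [shiftVar, sum_sq_eq_sum_eigenvalues_sq hA.1, dotProduct_mulVec_eq_sum_eigenvalues hA.1,
    Finset.sum_add_distrib]

theorem shiftVar_nonneg (hA : A.PosSemidef) (a : EuclideanSpace ℝ (Fin N)) : 0 ≤ shiftVar a A := by
  rw [shiftVar_eq_sum hA]
  refine Finset.sum_nonneg fun i _ => ?_
  have := hA.eigenvalues_nonneg i
  positivity

theorem shiftVar_le (hA : A.PosSemidef) (a : EuclideanSpace ℝ (Fin N)) :
    shiftVar a A ≤ (A.trace + ‖a‖ ^ 2) ^ 2 := by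
  have ht : A.trace = ∑ i, hA.1.eigenvalues i := by
    simpa using hA.1.trace_eq_sum_eigenvalues
  have hle : ∀ i, hA.1.eigenvalues i ≤ A.trace := fun i => by
    rw [ht]
    exact Finset.single_le_sum (fun j _ => hA.eigenvalues_nonneg j) (Finset.mem_univ i)
  have h0 : 0 ≤ A.trace := by rw [ht]; exact Finset.sum_nonneg fun i _ => hA.eigenvalues_nonneg i
  have hs : shiftVar a A ≤ ∑ i, (A.trace * hA.1.eigenvalues i +
      A.trace * inner ℝ (hA.1.eigenvectorBasis i) a ^ 2) := by
    rw [shiftVar_eq_sum hA]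
    refine Finset.sum_le_sum fun i _ => ?_
    have := hle i
    have := hA.eigenvalues_nonneg i
    rw [sq]
    gcongr
  refine hs.trans ?_
  rw [Finset.sum_add_distrib, ← Finset.mul_sum, ← Finset.mul_sum, ← ht,
    hA.1.eigenvectorBasis.sum_sq_inner_right]
  nlinarith [sq_nonneg ‖a‖]

/-- The fluctuations of `‖x‖²` around its mean `‖a‖² + tr A`, for `x ∼ 𝒩(a, A)`, have
second and fourth moments of the order of `shiftVar a A` and its square, uniformly in the
dimension. -/
theorem exists_norm_sq_moments : ∃ C : ℝ, 1 ≤ C ∧ ∀ (N : ℕ) (A : Matrix (Fin N) (Fin N) ℝ)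
    (_ : A.PosSemidef) (a : EuclideanSpace ℝ (Fin N)),
    ∫ x, (‖x‖ ^ 2 - (‖a‖ ^ 2 + A.trace)) ^ 2 ∂multivariateGaussian a A ≤ C * shiftVar a A ∧
    ∫ x, (‖x‖ ^ 2 - (‖a‖ ^ 2 + A.trace)) ^ 4 ∂multivariateGaussian a A ≤
      3 * (C * shiftVar a A) ^ 2 := by
  obtain ⟨C, hC, hmom⟩ := exists_gaussianReal_sq_moments
  refine ⟨C, hC, fun N A hA a => ?_⟩
  set b := hA.1.eigenvectorBasis
  set v : Fin N → NNReal := fun i => (hA.1.eigenvalues i).toNNReal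
  have hv : ∀ i, (v i : ℝ) = hA.1.eigenvalues i := fun i =>
    Real.coe_toNNReal _ (hA.eigenvalues_nonneg i)
  set c : Fin N → ℝ := fun i => inner ℝ (b i) a
  set μ : Fin N → Measure ℝ := fun i => gaussianReal (c i) (v i)
  set f : Fin N → ℝ → ℝ := fun i x => x ^ 2 - (c i ^ 2 + v i)
  have hf : ∀ i, HasMoments (f i) (μ i) := fun i =>
    ((hasMoments_gaussianReal _ _).pow 2).sub (HasMoments.const _)
  have hfc : ∀ i, Continuous (f i) := fun i => by simp only [f]; fun_prop
  have hev : ∀ i (g : ℝ → ℝ), Continuous g →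
      ∫ x, g (x i) ∂Measure.pi μ = ∫ y, g y ∂μ i := fun i g hg =>
    integral_comp_eval (hg.aestronglyMeasurable)
  have key := integral_sum_pow_le_of_iIndepFun (μ := Measure.pi μ) (X := fun i x => f i (x i))
    (fun i => (hf i).comp (measurePreserving_eval μ i))
    (fun i => (hfc i).measurable.comp (measurable_pi_apply i))
    (iIndepFun_pi fun i => (hfc i).aemeasurable)
    (fun i => by rw [hev i (f i) (hfc i)]; exact (hmom _ _).1)
    (v := fun i => C * ((v i : ℝ) ^ 2 + v i * c i ^ 2))
    (fun i => by
      rw [hev i (fun y => f i y ^ 2) ((hfc i).pow 2)]; exact (hmom _ _).2.1)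
    (fun i => by
      rw [hev i (fun y => f i y ^ 4) ((hfc i).pow 4)]; exact (hmom _ _).2.2) Finset.univ
  have hsum : ∑ i, C * ((v i : ℝ) ^ 2 + v i * c i ^ 2) = C * shiftVar a A := by
    rw [shiftVar_eq_sum hA, Finset.mul_sum]
    simp_rw [hv]
    rfl
  have hnorm : ∀ x : Fin N → ℝ, ‖∑ i, x i • b i‖ ^ 2 - (‖a‖ ^ 2 + A.trace) = ∑ i, f i (x i) := by
    intro x
    have h1 : ‖∑ i, x i • b i‖ ^ 2 = ∑ i, x i ^ 2 := by
      rw [← b.sum_sq_inner_right]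
      refine Finset.sum_congr rfl fun i _ => ?_
      congr 1
      simp [inner_sum, real_inner_smul_right, orthonormal_iff_ite.1 b.orthonormal]
    have h2 : ‖a‖ ^ 2 = ∑ i, c i ^ 2 := (b.sum_sq_inner_right a).symm
    have h3 : A.trace = ∑ i, (v i : ℝ) := by
      simp_rw [hv]
      simpa using hA.1.trace_eq_sum_eigenvalues
    simp only [f]
    rw [Finset.sum_sub_distrib, Finset.sum_add_distrib, h1, h2, h3]
  have hmap : ∀ n : ℕ, ∫ x, (‖x‖ ^ 2 - (‖a‖ ^ 2 + A.trace)) ^ n ∂multivariateGaussian a A =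
      ∫ x, (∑ i, f i (x i)) ^ n ∂Measure.pi μ := by
    intro n
    rw [multivariateGaussian_eq_map_pi hA, integral_map (Measurable.aemeasurable (by fun_prop))
      (Continuous.aestronglyMeasurable (by fun_prop))]
    exact integral_congr_ae (ae_of_all _ fun x => congrArg (· ^ n) (hnorm x))
  rw [hmap, hmap, ← hsum]
  exact key.2

/-- For independent `u, u' ∼ 𝒩(a, A)`, the inner product `⟪u, u'⟫` has mean `‖a‖²` and variance
`‖A‖_F² + 2 aᵀ A a`. -/
theorem integral_inner_multivariateGaussian (hA : A.PosSemidef) (a : EuclideanSpace ℝ (Fin N)) :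
    ∫ p, inner ℝ p.1 p.2 ∂((multivariateGaussian a A).prod (multivariateGaussian a A)) =
      ‖a‖ ^ 2 ∧
    ∫ p, inner ℝ p.1 p.2 ^ 2 ∂((multivariateGaussian a A).prod (multivariateGaussian a A)) =
      (‖a‖ ^ 2) ^ 2 + ((∑ i, ∑ j, A i j ^ 2) + 2 * (a.ofLp ⬝ᵥ A.mulVec a.ofLp)) := by
  set μ := multivariateGaussian a A
  have hc : ∀ i, HasMoments (fun x : EuclideanSpace ℝ (Fin N) => x i) μ := hasMoments_coord a
  have h1 : ∀ i, HasMoments (fun p : EuclideanSpace ℝ (Fin N) × EuclideanSpace ℝ (Fin N) => p.1 i)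
      (μ.prod μ) := fun i => (hc i).comp measurePreserving_fst
  have h2 : ∀ i, HasMoments (fun p : EuclideanSpace ℝ (Fin N) × EuclideanSpace ℝ (Fin N) => p.2 i)
      (μ.prod μ) := fun i => (hc i).comp measurePreserving_snd
  have hin : ∀ p : EuclideanSpace ℝ (Fin N) × EuclideanSpace ℝ (Fin N),
      inner ℝ p.1 p.2 = ∑ i, p.1 i * p.2 i := by
    intro p
    simp [PiLp.inner_apply, mul_comm]
  have hnorm : ‖a‖ ^ 2 = ∑ i, a i * a i := by
    rw [EuclideanSpace.real_norm_sq_eq]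
    simp_rw [sq]
  constructor
  · simp_rw [hin]
    rw [integral_finsetSum _ fun i _ => ((h1 i).mul (h2 i)).integrable, hnorm]
    refine Finset.sum_congr rfl fun i _ => ?_
    rw [integral_prod_mul (fun x : EuclideanSpace ℝ (Fin N) => x i)
      (fun x : EuclideanSpace ℝ (Fin N) => x i), integral_coord]
  · have e : ∀ p : EuclideanSpace ℝ (Fin N) × EuclideanSpace ℝ (Fin N),
        inner ℝ p.1 p.2 ^ 2 = ∑ i, ∑ j, (p.1 i * p.1 j) * (p.2 i * p.2 j) := by
      intro p
      rw [hin, sq, Finset.sum_mul_sum]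
      refine Finset.sum_congr rfl fun i _ => Finset.sum_congr rfl fun j _ => ?_
      ring
    simp_rw [e]
    have hI : ∀ i j, Integrable (fun p : EuclideanSpace ℝ (Fin N) × EuclideanSpace ℝ (Fin N) =>
        (p.1 i * p.1 j) * (p.2 i * p.2 j)) (μ.prod μ) := fun i j =>
      (((h1 i).mul (h1 j)).mul ((h2 i).mul (h2 j))).integrable
    rw [integral_finsetSum _ fun i _ => integrable_finsetSum _ fun j _ => hI i j]
    have e2 : ∀ i, ∫ p, (∑ j, (p.1 i * p.1 j) * (p.2 i * p.2 j)) ∂(μ.prod μ) =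
        ∑ j, (a i * a j + A i j) ^ 2 := by
      intro i
      rw [integral_finsetSum _ fun j _ => hI i j]
      refine Finset.sum_congr rfl fun j _ => ?_
      rw [integral_prod_mul (fun x : EuclideanSpace ℝ (Fin N) => x i * x j)
        (fun x : EuclideanSpace ℝ (Fin N) => x i * x j), integral_coord_mul_coord hA, sq]
    simp_rw [e2]
    have e3 : ∀ i j, (a i * a j + A i j) ^ 2 =
        (a i * a i) * (a j * a j) + (A i j ^ 2 + 2 * (a i * (A i j * a j))) := fun i j => by ring
    simp_rw [e3, Finset.sum_add_distrib, ← Finset.mul_sum]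
    rw [hnorm, sq, Finset.sum_mul]
    rfl

end MultivariateGaussian

/-! ### Linearisation of the Gauss kernel -/

/-- Linearisation of `e^{-x}` around `y`, with slope `-1` instead of `-e^{-y}`. -/
theorem abs_exp_neg_sub_le {x y : ℝ} (hx : 0 ≤ x) (hy : 0 ≤ y) :
    |Real.exp (-x) - Real.exp (-y) + (x - y)| ≤ (x - y) ^ 2 + y * |x - y| := by
  set s := x - y with hs
  have hxy : Real.exp (-x) = Real.exp (-y) * Real.exp (-s) := by
    rw [← Real.exp_add]; congr 1; rw [hs]; ring
  have hy1 : Real.exp (-y) ≤ 1 := by rw [Real.exp_le_one_iff]; linarith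
  have hy0 : 0 < Real.exp (-y) := Real.exp_pos _
  have hy2 : 1 - Real.exp (-y) ≤ y := by linarith [Real.add_one_le_exp (-y)]
  have hlow : 0 ≤ Real.exp (-s) - 1 + s := by linarith [Real.add_one_le_exp (-s)]
  have hup : Real.exp (-y) * (Real.exp (-s) - 1 + s) ≤ s ^ 2 := by
    rcases le_total 0 s with h | h
    · have h1 : Real.exp (-s) * (1 + s) ≤ 1 := by
        have := mul_le_mul_of_nonneg_left (Real.add_one_le_exp s) (Real.exp_pos (-s)).le
        rw [← Real.exp_add, neg_add_cancel, Real.exp_zero] at this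
        linarith
      have h2 : Real.exp (-s) - 1 + s ≤ s ^ 2 := by
        have : (Real.exp (-s) - 1 + s) * (1 + s) ≤ s ^ 2 := by nlinarith
        nlinarith
      nlinarith
    · -- here `e^{-y} ≤ e^s`, as `x = y + s ≥ 0`
      have h1 : Real.exp (-y) ≤ Real.exp s := Real.exp_le_exp.2 (by linarith)
      have h2 : Real.exp s * (Real.exp (-s) - 1 + s) ≤ s ^ 2 := by
        have e : Real.exp s * Real.exp (-s) = 1 := by rw [← Real.exp_add]; simp
        have := Real.add_one_le_exp s
        nlinarith
      exact (mul_le_mul_of_nonneg_right h1 hlow).trans h2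
  have e : Real.exp (-x) - Real.exp (-y) + s =
      Real.exp (-y) * (Real.exp (-s) - 1 + s) + (1 - Real.exp (-y)) * s := by
    rw [hxy]; ring
  rw [e]
  refine (abs_add_le _ _).trans (add_le_add ?_ ?_)
  · rwa [abs_of_nonneg (mul_nonneg hy0.le hlow)]
  · rw [abs_mul, abs_of_nonneg (by linarith)]
    exact mul_le_mul_of_nonneg_right hy2 (abs_nonneg _)

theorem hasMoments_exp_neg_norm_sq {N : ℕ} (μ : Measure (EuclideanSpace ℝ (Fin N)))
    [IsFiniteMeasure μ] {l : ℝ} (hl : 0 ≤ l) :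
    HasMoments (fun x => Real.exp (-(l * ‖x‖ ^ 2))) μ := by
  refine HasMoments.of_bound (Continuous.aestronglyMeasurable (by fun_prop)) 1 fun x => ?_
  rw [abs_of_pos (Real.exp_pos _), Real.exp_le_one_iff]
  have : 0 ≤ l * ‖x‖ ^ 2 := by positivity
  linarith

/-- Errors of the linearisation of `e^{-l ‖x‖²}` around its mean `ρ` and around `0`, for a Gaussian
vector `x`. The first error is small compared to the standard deviation of `l ‖x‖²`, and
not only to its mean, as soon as `l ρ` is small. -/
theorem exists_exp_neg_norm_sq_bounds : ∃ C : ℝ, 0 ≤ C ∧ ∀ (N : ℕ)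
    (A : Matrix (Fin N) (Fin N) ℝ) (_ : A.PosSemidef) (a : EuclideanSpace ℝ (Fin N)) (l : ℝ)
    (_ : 0 ≤ l),
    ∫ x, (Real.exp (-(l * ‖x‖ ^ 2)) - Real.exp (-(l * (‖a‖ ^ 2 + A.trace)))
        + l * (‖x‖ ^ 2 - (‖a‖ ^ 2 + A.trace))) ^ 2 ∂multivariateGaussian a A ≤
      C * (l ^ 4 * (‖a‖ ^ 2 + A.trace) ^ 2 * shiftVar a A) ∧
    ∫ x, |Real.exp (-(l * ‖x‖ ^ 2)) - 1 + l * ‖x‖ ^ 2| ∂multivariateGaussian a A ≤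
      C * (l ^ 2 * (‖a‖ ^ 2 + A.trace) ^ 2) := by
  obtain ⟨C, hC, hmom⟩ := exists_norm_sq_moments
  refine ⟨2 * (3 * C ^ 2 + C) + 2 * (1 + C), by positivity, fun N A hA a l hl => ?_⟩
  obtain ⟨h2, h4⟩ := hmom N A hA a
  set ρ := ‖a‖ ^ 2 + A.trace
  set V := shiftVar a A
  set μ := multivariateGaussian a A
  have hρ : 0 ≤ ρ := add_nonneg (sq_nonneg _) hA.trace_nonneg
  have hV : 0 ≤ V := shiftVar_nonneg hA a
  have hVρ : V ≤ ρ ^ 2 := by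
    have := shiftVar_le hA a
    rwa [add_comm] at this
  have hn : HasMoments (fun x : EuclideanSpace ℝ (Fin N) => ‖x‖ ^ 2) μ := hasMoments_norm_sq a
  have hd : HasMoments (fun x : EuclideanSpace ℝ (Fin N) => ‖x‖ ^ 2 - ρ) μ :=
    hn.sub (HasMoments.const _)
  have he := hasMoments_exp_neg_norm_sq μ hl
  constructor
  · have hle : ∀ x : EuclideanSpace ℝ (Fin N),
        (Real.exp (-(l * ‖x‖ ^ 2)) - Real.exp (-(l * ρ)) + l * (‖x‖ ^ 2 - ρ)) ^ 2 ≤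
          2 * l ^ 4 * (‖x‖ ^ 2 - ρ) ^ 4 + 2 * l ^ 4 * ρ ^ 2 * (‖x‖ ^ 2 - ρ) ^ 2 := by
      intro x
      have h := abs_exp_neg_sub_le (x := l * ‖x‖ ^ 2) (y := l * ρ) (by positivity) (by positivity)
      rw [← mul_sub] at h
      set d := ‖x‖ ^ 2 - ρ
      rw [abs_mul l d, abs_of_nonneg hl] at h
      calc _ = |Real.exp (-(l * ‖x‖ ^ 2)) - Real.exp (-(l * ρ)) + l * d| ^ 2 := (sq_abs _).symm
        _ ≤ ((l * d) ^ 2 + l * ρ * (l * |d|)) ^ 2 := pow_le_pow_left₀ (abs_nonneg _) h 2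
        _ ≤ 2 * (((l * d) ^ 2) ^ 2 + (l * ρ * (l * |d|)) ^ 2) := by
          nlinarith [sq_nonneg ((l * d) ^ 2 - l * ρ * (l * |d|))]
        _ = _ := by rw [mul_pow (l * ρ), mul_pow l |d|, sq_abs]; ring
    refine (integral_mono (((he.sub (HasMoments.const _)).add (hd.const_mul l)).pow 2).integrable
      (((hd.pow 4).const_mul _).add ((hd.pow 2).const_mul _)).integrable hle).trans ?_
    rw [integral_add ((hd.pow 4).const_mul _).integrable ((hd.pow 2).const_mul _).integrable,
      integral_const_mul, integral_const_mul]
    have hl4 : 0 ≤ l ^ 4 := by positivity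
    calc 2 * l ^ 4 * ∫ x, (‖x‖ ^ 2 - ρ) ^ 4 ∂μ + 2 * l ^ 4 * ρ ^ 2 * ∫ x, (‖x‖ ^ 2 - ρ) ^ 2 ∂μ
        ≤ 2 * l ^ 4 * (3 * (C * V) ^ 2) + 2 * l ^ 4 * ρ ^ 2 * (C * V) := by gcongr
      _ = 2 * (3 * C ^ 2) * (l ^ 4 * V * V) + 2 * C * (l ^ 4 * ρ ^ 2 * V) := by ring
      _ ≤ 2 * (3 * C ^ 2) * (l ^ 4 * ρ ^ 2 * V) + 2 * C * (l ^ 4 * ρ ^ 2 * V) := by gcongr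
      _ = 2 * (3 * C ^ 2 + C) * (l ^ 4 * ρ ^ 2 * V) := by ring
      _ ≤ _ := by
          refine mul_le_mul_of_nonneg_right ?_ (by positivity)
          nlinarith
  · have hle : ∀ x : EuclideanSpace ℝ (Fin N),
        |Real.exp (-(l * ‖x‖ ^ 2)) - 1 + l * ‖x‖ ^ 2| ≤
          l ^ 2 * (2 * ρ ^ 2) + 2 * l ^ 2 * (‖x‖ ^ 2 - ρ) ^ 2 := by
      intro x
      have h := abs_exp_neg_sub_le (x := l * ‖x‖ ^ 2) (y := 0) (by positivity) le_rfl
      simp only [neg_zero, Real.exp_zero, sub_zero, zero_mul, add_zero] at h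
      refine h.trans ?_
      have : (‖x‖ ^ 2) ^ 2 ≤ 2 * ρ ^ 2 + 2 * (‖x‖ ^ 2 - ρ) ^ 2 := by
        nlinarith [sq_nonneg (‖x‖ ^ 2 - 2 * ρ)]
      have := mul_le_mul_of_nonneg_left this (sq_nonneg l)
      linarith
    have hi : HasMoments (fun x : EuclideanSpace ℝ (Fin N) =>
        Real.exp (-(l * ‖x‖ ^ 2)) - 1 + l * ‖x‖ ^ 2) μ :=
      (he.sub (HasMoments.const _)).add (hn.const_mul l)
    refine (integral_mono hi.abs.integrable
      ((HasMoments.const _).add ((hd.pow 2).const_mul _)).integrable hle).trans ?_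
    rw [integral_add (integrable_const _) ((hd.pow 2).const_mul _).integrable, integral_const,
      integral_const_mul (2 * l ^ 2)]
    simp only [probReal_univ, smul_eq_mul, one_mul]
    calc l ^ 2 * (2 * ρ ^ 2) + 2 * l ^ 2 * ∫ x, (‖x‖ ^ 2 - ρ) ^ 2 ∂μ
        ≤ l ^ 2 * (2 * ρ ^ 2) + 2 * l ^ 2 * (C * ρ ^ 2) := by
          have : C * V ≤ C * ρ ^ 2 := by gcongr
          gcongr
          exact h2.trans this
      _ = 2 * (1 + C) * (l ^ 2 * ρ ^ 2) := by ring
      _ ≤ _ := by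
          refine mul_le_mul_of_nonneg_right ?_ (by positivity)
          nlinarith

/-! ### Perturbation of the standard deviation -/

section StandardDeviation

variable {Ω : Type*} [MeasurableSpace Ω] {μ : Measure Ω} [IsProbabilityMeasure μ] {X Y : Ω → ℝ}

/-- Minkowski's inequality for the standard deviation. -/
theorem sqrt_variance_add_le (hX : MemLp X 2 μ) (hY : MemLp Y 2 μ) :
    √Var[fun ω => X ω + Y ω; μ] ≤ √Var[X; μ] + √Var[Y; μ] := by
  have hquad : ∀ t : ℝ, 0 ≤ Var[Y; μ] * (t * t) + 2 * cov[X, Y; μ] * t + Var[X; μ] := by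
    intro t
    have h := variance_nonneg (fun ω => X ω + t * Y ω) μ
    rw [variance_fun_add hX (hY.const_mul t), variance_const_mul, covariance_const_mul_right] at h
    linarith
  have hdisc := discrim_le_zero hquad
  rw [discrim] at hdisc
  have hcov : cov[X, Y; μ] ≤ √Var[X; μ] * √Var[Y; μ] := by
    rw [← Real.sqrt_mul (variance_nonneg _ _)]
    exact Real.le_sqrt_of_sq_le (by nlinarith)
  rw [variance_fun_add hX hY]
  refine Real.sqrt_le_iff.2 ⟨by positivity, ?_⟩
  have h1 := Real.sq_sqrt (variance_nonneg X μ)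
  have h2 := Real.sq_sqrt (variance_nonneg Y μ)
  nlinarith

theorem abs_sqrt_variance_add_sub_le (hX : MemLp X 2 μ) (hY : MemLp Y 2 μ) :
    |√Var[fun ω => X ω + Y ω; μ] - √Var[X; μ]| ≤ √(∫ ω, Y ω ^ 2 ∂μ) := by
  have hle : √Var[Y; μ] ≤ √(∫ ω, Y ω ^ 2 ∂μ) :=
    Real.sqrt_le_sqrt (variance_le_expectation_sq hY.1)
  have h1 := sqrt_variance_add_le hX hY
  have h2 := sqrt_variance_add_le (hX.add hY) hY.neg
  have e : (fun ω => (X + Y) ω + (-Y) ω) = X := by ext ω; simp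
  rw [e, variance_neg] at h2
  change √Var[X; μ] ≤ √Var[fun ω => X ω + Y ω; μ] + _ at h2
  rw [abs_le]
  constructor <;> linarith

end StandardDeviation

/-! ### The mean-shift problem for finitely many observations -/

section MeanShift

variable {N : ℕ} {A : Matrix (Fin N) (Fin N) ℝ}

theorem shiftVar_zero_two_smul_le (hA : A.PosSemidef) (a : EuclideanSpace ℝ (Fin N)) :
    shiftVar 0 ((2 : ℝ) • A) ≤ 4 * shiftVar a A := by
  have h : 0 ≤ a.ofLp ⬝ᵥ A.mulVec a.ofLp := by simpa using hA.dotProduct_mulVec_nonneg a.ofLp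
  simp only [shiftVar, Matrix.smul_apply, smul_eq_mul, mul_pow, ← Finset.mul_sum,
    WithLp.ofLp_zero, zero_dotProduct]
  linarith

theorem shiftVar_neg_two_smul_le (hA : A.PosSemidef) (a : EuclideanSpace ℝ (Fin N)) :
    shiftVar (-a) ((2 : ℝ) • A) ≤ 4 * shiftVar a A := by
  have h : 0 ≤ a.ofLp ⬝ᵥ A.mulVec a.ofLp := by simpa using hA.dotProduct_mulVec_nonneg a.ofLp
  simp only [shiftVar, Matrix.smul_apply, smul_eq_mul, mul_pow, ← Finset.mul_sum,
    WithLp.ofLp_neg, Matrix.mulVec_neg, neg_dotProduct_neg, Matrix.smul_mulVec, dotProduct_smul]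
  linarith

theorem gaussKernel_eq_exp (γ : ℝ) (x y : EuclideanSpace ℝ (Fin N)) :
    gaussKernel γ x y = Real.exp (-((γ ^ 2)⁻¹ / 2 * ‖x - y‖ ^ 2)) := by
  rw [gaussKernel]
  congr 1
  ring

theorem norm_sub_sq_combination (x y x' y' : EuclideanSpace ℝ (Fin N)) :
    ‖x - x'‖ ^ 2 + ‖y - y'‖ ^ 2 - ‖x - y'‖ ^ 2 - ‖y - x'‖ ^ 2 =
      -(2 * inner ℝ (x - y) (x' - y')) := by
  simp only [norm_sub_sq_real, inner_sub_left, inner_sub_right]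
  ring

/-- The space of `N` real observations. -/
abbrev Obs (N : ℕ) : Type := EuclideanSpace ℝ (Fin N)

/-- The law of `((x, y), (x', y'))` for independent `x, x' ∼ 𝒩(0, A)` and `y, y' ∼ 𝒩(a, A)`. -/
noncomputable def pairLaw (a : Obs N) (A : Matrix (Fin N) (Fin N) ℝ) :
    Measure ((Obs N × Obs N) × (Obs N × Obs N)) :=
  ((multivariateGaussian 0 A).prod (multivariateGaussian a A)).prod
    ((multivariateGaussian 0 A).prod (multivariateGaussian a A))

instance isProbabilityMeasure_pairLaw (a : Obs N) : IsProbabilityMeasure (pairLaw a A) := by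
  unfold pairLaw
  infer_instance

theorem measurePreserving_sub (hA : A.PosSemidef) (b c : Obs N) :
    MeasurePreserving (fun p : Obs N × Obs N => p.1 - p.2)
      ((multivariateGaussian b A).prod (multivariateGaussian c A))
      (multivariateGaussian (b - c) ((2 : ℝ) • A)) :=
  ⟨by fun_prop, map_sub_multivariateGaussian hA b c⟩

theorem measurePreserving_sub_same (hA : A.PosSemidef) (b : Obs N) :
    MeasurePreserving (fun p : Obs N × Obs N => p.1 - p.2)
      ((multivariateGaussian b A).prod (multivariateGaussian b A))
      (multivariateGaussian 0 ((2 : ℝ) • A)) := by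
  simpa using measurePreserving_sub hA b b

theorem measurePreserving_sub_shift (hA : A.PosSemidef) (a : Obs N) :
    MeasurePreserving (fun p : Obs N × Obs N => p.1 - p.2)
      ((multivariateGaussian 0 A).prod (multivariateGaussian a A))
      (multivariateGaussian (-a) ((2 : ℝ) • A)) := by
  simpa using measurePreserving_sub hA 0 a

theorem measurePreserving_pairLaw_fst_fst (hA : A.PosSemidef) (a : Obs N) :
    MeasurePreserving (fun w : (Obs N × Obs N) × (Obs N × Obs N) => w.1.1 - w.2.1) (pairLaw a A)
      (multivariateGaussian 0 ((2 : ℝ) • A)) :=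
  (measurePreserving_sub_same hA 0).comp (measurePreserving_fst.prod measurePreserving_fst)

theorem measurePreserving_pairLaw_snd_snd (hA : A.PosSemidef) (a : Obs N) :
    MeasurePreserving (fun w : (Obs N × Obs N) × (Obs N × Obs N) => w.1.2 - w.2.2) (pairLaw a A)
      (multivariateGaussian 0 ((2 : ℝ) • A)) :=
  (measurePreserving_sub_same hA a).comp (measurePreserving_snd.prod measurePreserving_snd)

theorem measurePreserving_pairLaw_fst_snd (hA : A.PosSemidef) (a : Obs N) :
    MeasurePreserving (fun w : (Obs N × Obs N) × (Obs N × Obs N) => w.1.1 - w.2.2) (pairLaw a A)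
      (multivariateGaussian (-a) ((2 : ℝ) • A)) :=
  (measurePreserving_sub_shift hA a).comp (measurePreserving_fst.prod measurePreserving_snd)

theorem measurePreserving_pairLaw_snd_fst (hA : A.PosSemidef) (a : Obs N) :
    MeasurePreserving (fun w : (Obs N × Obs N) × (Obs N × Obs N) => w.2.1 - w.1.2) (pairLaw a A)
      (multivariateGaussian (-a) ((2 : ℝ) • A)) :=
  (measurePreserving_pairLaw_fst_snd hA a).comp Measure.measurePreserving_swap

theorem measurePreserving_pairLaw_sub_sub (hA : A.PosSemidef) (a : Obs N) :
    MeasurePreserving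
      (fun w : (Obs N × Obs N) × (Obs N × Obs N) => (w.1.1 - w.1.2, w.2.1 - w.2.2)) (pairLaw a A)
      ((multivariateGaussian (-a) ((2 : ℝ) • A)).prod
        (multivariateGaussian (-a) ((2 : ℝ) • A))) :=
  (measurePreserving_sub_shift hA a).prod (measurePreserving_sub_shift hA a)

theorem integral_comp_of_measurePreserving {Ω F : Type*} [MeasurableSpace Ω] [MeasurableSpace F]
    {ν : Measure Ω} {μ : Measure F} {φ : Ω → F} (hφ : MeasurePreserving φ ν μ) {f : F → ℝ}
    (hf : AEStronglyMeasurable f μ) : ∫ w, f (φ w) ∂ν = ∫ x, f x ∂μ := by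
  rw [← hφ.map_eq, integral_map hφ.measurable.aemeasurable (by rwa [hφ.map_eq])]

theorem hasMoments_inner (a : Obs N) :
    HasMoments (fun p : Obs N × Obs N => inner ℝ p.1 p.2)
      ((multivariateGaussian a A).prod (multivariateGaussian a A)) := by
  have hin : ∀ p : Obs N × Obs N, inner ℝ p.1 p.2 = ∑ i, p.1 i * p.2 i := by
    intro p
    simp [PiLp.inner_apply, mul_comm]
  simp_rw [hin]
  exact HasMoments.sum _ fun i _ => ((hasMoments_coord _ i).comp measurePreserving_fst).mul
    ((hasMoments_coord _ i).comp measurePreserving_snd)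

/-- Mean and variance of the main term `⟪x - y, x' - y'⟫` of `h`. -/
theorem pairLaw_inner (hA : A.PosSemidef) (a : Obs N) :
    HasMoments (fun w : (Obs N × Obs N) × (Obs N × Obs N) =>
      inner ℝ (w.1.1 - w.1.2) (w.2.1 - w.2.2)) (pairLaw a A) ∧
    ∫ w : (Obs N × Obs N) × (Obs N × Obs N), inner ℝ (w.1.1 - w.1.2) (w.2.1 - w.2.2) ∂pairLaw a A =
      ‖a‖ ^ 2 ∧
    Var[fun w : (Obs N × Obs N) × (Obs N × Obs N) =>
      inner ℝ (w.1.1 - w.1.2) (w.2.1 - w.2.2); pairLaw a A] = 4 * shiftVar a A := by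
  have h2A : ((2 : ℝ) • A).PosSemidef := hA.smul (by norm_num)
  have huu := measurePreserving_pairLaw_sub_sub hA a
  obtain ⟨hI1, hI2⟩ := integral_inner_multivariateGaussian h2A (-a)
  rw [norm_neg] at hI1 hI2
  have hDm := hasMoments_inner (A := (2 : ℝ) • A) (-a)
  have hD := hDm.comp huu
  have hD1 : ∫ w : (Obs N × Obs N) × (Obs N × Obs N),
      inner ℝ (w.1.1 - w.1.2) (w.2.1 - w.2.2) ∂pairLaw a A = ‖a‖ ^ 2 := by
    rw [← hI1]
    exact integral_comp_of_measurePreserving huu hDm.aestronglyMeasurable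
  refine ⟨hD, hD1, ?_⟩
  have h := integral_comp_of_measurePreserving huu (hDm.pow 2).aestronglyMeasurable
  have hV := variance_eq_sub hD.memLp_two
  rw [hD1] at hV
  have hV' := h.trans hI2
  rw [hV, show (∫ w, ((fun w : (Obs N × Obs N) × (Obs N × Obs N) =>
    inner ℝ (w.1.1 - w.1.2) (w.2.1 - w.2.2)) ^ 2) w ∂pairLaw a A) = _ from hV']
  simp only [shiftVar, Matrix.smul_apply, smul_eq_mul, mul_pow, ← Finset.mul_sum,
    WithLp.ofLp_neg, Matrix.mulVec_neg, neg_dotProduct_neg, Matrix.smul_mulVec, dotProduct_smul]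
  ring

/-- Two linearisations of one of the terms `e^{-l r}` of `h`, where `r` is the squared norm of a
difference `φ` of two observations. Around the mean of `r`, as `c - l r + R`, the error `R` is small
in `L²` compared to the standard deviation of `l r`. The constants `c` of the four terms are
irrelevant for the variance of `h`, but not for its mean, which is computed from the linearisation
around `0`. -/
theorem exists_linearisation : ∃ C : ℝ, 0 ≤ C ∧ ∀ (N : ℕ)
    (A : Matrix (Fin N) (Fin N) ℝ) (_ : A.PosSemidef) (a b : Obs N) (l : ℝ) (_ : 0 ≤ l)
    (φ : (Obs N × Obs N) × (Obs N × Obs N) → Obs N)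
    (_ : MeasurePreserving φ (pairLaw a A) (multivariateGaussian b ((2 : ℝ) • A)))
    (_ : ‖b‖ ^ 2 ≤ ‖a‖ ^ 2) (_ : shiftVar b ((2 : ℝ) • A) ≤ 4 * shiftVar a A),
    (∃ (c : ℝ) (R : (Obs N × Obs N) × (Obs N × Obs N) → ℝ),
      (∀ w, Real.exp (-(l * ‖φ w‖ ^ 2)) = c - l * ‖φ w‖ ^ 2 + R w) ∧ HasMoments R (pairLaw a A) ∧
      ∫ w, R w ^ 2 ∂pairLaw a A ≤
        16 * C * (l ^ 4 * (A.trace + ‖a‖ ^ 2) ^ 2 * shiftVar a A)) ∧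
    HasMoments (fun w => Real.exp (-(l * ‖φ w‖ ^ 2)) - 1 + l * ‖φ w‖ ^ 2) (pairLaw a A) ∧
    |∫ w, (Real.exp (-(l * ‖φ w‖ ^ 2)) - 1 + l * ‖φ w‖ ^ 2) ∂pairLaw a A| ≤
      4 * C * (l ^ 2 * (A.trace + ‖a‖ ^ 2) ^ 2) := by
  obtain ⟨C, hC, hexp⟩ := exists_exp_neg_norm_sq_bounds
  refine ⟨C, hC, fun N A hA a b l hl φ hφ hb hV => ?_⟩
  have h2A : ((2 : ℝ) • A).PosSemidef := hA.smul (by norm_num)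
  have htr : 0 ≤ A.trace := hA.trace_nonneg
  set T := A.trace + ‖a‖ ^ 2
  have hT : 0 ≤ T := by positivity
  obtain ⟨hb1, hb2⟩ := hexp N _ h2A b l hl
  set ρ := ‖b‖ ^ 2 + ((2 : ℝ) • A).trace
  have hρ0 : 0 ≤ ρ := add_nonneg (sq_nonneg _) h2A.trace_nonneg
  have hρ : ρ ≤ 2 * T := by
    simp only [ρ, T, Matrix.trace_smul, smul_eq_mul]
    linarith [sq_nonneg ‖a‖]
  have hn := hasMoments_norm_sq (A := (2 : ℝ) • A) b
  have he := hasMoments_exp_neg_norm_sq (multivariateGaussian b ((2 : ℝ) • A)) hl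
  have hR := (he.sub (HasMoments.const (Real.exp (-(l * ρ))))).add
    ((hn.sub (HasMoments.const ρ)).const_mul l)
  have hR' := (he.sub (HasMoments.const 1)).add (hn.const_mul l)
  have hV0 := shiftVar_nonneg h2A b
  refine ⟨⟨Real.exp (-(l * ρ)) + l * ρ, fun w => Real.exp (-(l * ‖φ w‖ ^ 2))
    - Real.exp (-(l * ρ)) + l * (‖φ w‖ ^ 2 - ρ), fun w => by ring, hR.comp hφ, ?_⟩,
    hR'.comp hφ, ?_⟩
  · have h := integral_comp_of_measurePreserving hφ (hR.pow 2).aestronglyMeasurable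
    rw [h]
    refine hb1.trans ?_
    calc C * (l ^ 4 * ρ ^ 2 * shiftVar b ((2 : ℝ) • A))
        ≤ C * (l ^ 4 * (2 * T) ^ 2 * (4 * shiftVar a A)) := by gcongr
      _ = _ := by ring
  · have h := integral_comp_of_measurePreserving hφ hR'.aestronglyMeasurable
    rw [h]
    refine (abs_integral_le_integral_abs).trans (hb2.trans ?_)
    calc C * (l ^ 2 * ρ ^ 2) ≤ C * (l ^ 2 * (2 * T) ^ 2) := by gcongr
      _ = _ := by ring

theorem hCore_gaussKernel (γ : ℝ) (w : (Obs N × Obs N) × (Obs N × Obs N)) :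
    hCore (gaussKernel γ) w.1 w.2 =
      Real.exp (-((γ ^ 2)⁻¹ / 2 * ‖w.1.1 - w.2.1‖ ^ 2))
        + Real.exp (-((γ ^ 2)⁻¹ / 2 * ‖w.1.2 - w.2.2‖ ^ 2))
        - Real.exp (-((γ ^ 2)⁻¹ / 2 * ‖w.1.1 - w.2.2‖ ^ 2))
        - Real.exp (-((γ ^ 2)⁻¹ / 2 * ‖w.2.1 - w.1.2‖ ^ 2)) := by
  simp only [hCore]
  rw [gaussKernel_eq_exp, gaussKernel_eq_exp, gaussKernel_eq_exp, gaussKernel_eq_exp]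

/-- The squared `L²` norm of the total error of the four terms of `h`. -/
theorem integral_sq_combination_le {Ω : Type*} [MeasurableSpace Ω] {ν : Measure Ω}
    [IsFiniteMeasure ν] {R1 R2 R3 R4 : Ω → ℝ} (m1 : HasMoments R1 ν) (m2 : HasMoments R2 ν)
    (m3 : HasMoments R3 ν) (m4 : HasMoments R4 ν) {s : ℝ} (s1 : ∫ w, R1 w ^ 2 ∂ν ≤ s)
    (s2 : ∫ w, R2 w ^ 2 ∂ν ≤ s) (s3 : ∫ w, R3 w ^ 2 ∂ν ≤ s) (s4 : ∫ w, R4 w ^ 2 ∂ν ≤ s) :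
    ∫ w, (R1 w + R2 w - R3 w - R4 w) ^ 2 ∂ν ≤ 16 * s := by
  have hle : ∀ w, (R1 w + R2 w - R3 w - R4 w) ^ 2 ≤
      4 * R1 w ^ 2 + 4 * R2 w ^ 2 + 4 * R3 w ^ 2 + 4 * R4 w ^ 2 := by
    intro w
    nlinarith [sq_nonneg (R1 w - R2 w), sq_nonneg (R1 w + R3 w), sq_nonneg (R1 w + R4 w),
      sq_nonneg (R2 w + R3 w), sq_nonneg (R2 w + R4 w), sq_nonneg (R3 w - R4 w)]
  have q1 := (m1.pow 2).const_mul 4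
  have q2 := (m2.pow 2).const_mul 4
  have q3 := (m3.pow 2).const_mul 4
  have q4 := (m4.pow 2).const_mul 4
  refine (integral_mono ((((m1.add m2).sub m3).sub m4).pow 2).integrable
    (((q1.add q2).add q3).add q4).integrable hle).trans ?_
  rw [integral_add ((q1.add q2).add q3).integrable q4.integrable,
    integral_add (q1.add q2).integrable q3.integrable,
    integral_add q1.integrable q2.integrable, integral_const_mul, integral_const_mul,
    integral_const_mul, integral_const_mul]
  linarith

/-- For `P = 𝒩(0, A)`, `Q = 𝒩(a, A)` and `l = 1 / (2 γ²)`, the function `h(z, z')` is, up to a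
constant, close to `2 l ⟪x - y, x' - y'⟫`, which has mean `2 l ‖a‖²` and standard deviation
`4 l (shiftVar a A)^{1/2}`. The error for the standard deviation
is small relative to it as soon as `l (tr A + ‖a‖²)` is. -/
theorem exists_mmd_xi₂_bounds : ∃ C : ℝ, 0 ≤ C ∧ ∀ (N : ℕ)
    (A : Matrix (Fin N) (Fin N) ℝ) (_ : A.PosSemidef) (a : EuclideanSpace ℝ (Fin N)) (γ : ℝ),
    |mmd (gaussKernel γ) (multivariateGaussian 0 A) (multivariateGaussian a A) ^ 2
        - 2 * ((γ ^ 2)⁻¹ / 2) * ‖a‖ ^ 2| ≤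
      C * (((γ ^ 2)⁻¹ / 2) ^ 2 * (A.trace + ‖a‖ ^ 2) ^ 2) ∧
    |√(xi₂ (gaussKernel γ) (multivariateGaussian 0 A) (multivariateGaussian a A))
        - 4 * ((γ ^ 2)⁻¹ / 2) * √(shiftVar a A)| ≤
      C * (((γ ^ 2)⁻¹ / 2) ^ 2 * (A.trace + ‖a‖ ^ 2) * √(shiftVar a A)) := by
  obtain ⟨C, hC, hlin⟩ := exists_linearisation
  refine ⟨16 * C + √(256 * C), by positivity, fun N A hA a γ => ?_⟩
  have hl : 0 ≤ (γ ^ 2)⁻¹ / 2 := by positivity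
  have hh := hCore_gaussKernel (N := N) γ
  have hmmd := mmd_gaussKernel_sq γ (multivariateGaussian 0 A) (multivariateGaussian a A)
  generalize (γ ^ 2)⁻¹ / 2 = l at hl hh ⊢
  have hT : 0 ≤ A.trace + ‖a‖ ^ 2 := add_nonneg hA.trace_nonneg (sq_nonneg _)
  have hS : 0 ≤ shiftVar a A := shiftVar_nonneg hA a
  obtain ⟨hD, hD1, hD2⟩ := pairLaw_inner hA a
  obtain ⟨⟨c1, R1, e1, m1, s1⟩, n1, t1⟩ := hlin N A hA a 0 l hl _
    (measurePreserving_pairLaw_fst_fst hA a) (by simp) (shiftVar_zero_two_smul_le hA a)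
  obtain ⟨⟨c2, R2, e2, m2, s2⟩, n2, t2⟩ := hlin N A hA a 0 l hl _
    (measurePreserving_pairLaw_snd_snd hA a) (by simp) (shiftVar_zero_two_smul_le hA a)
  obtain ⟨⟨c3, R3, e3, m3, s3⟩, n3, t3⟩ := hlin N A hA a (-a) l hl _
    (measurePreserving_pairLaw_fst_snd hA a) (by simp) (shiftVar_neg_two_smul_le hA a)
  obtain ⟨⟨c4, R4, e4, m4, s4⟩, n4, t4⟩ := hlin N A hA a (-a) l hl _
    (measurePreserving_pairLaw_snd_fst hA a) (by simp) (shiftVar_neg_two_smul_le hA a)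
  generalize A.trace + ‖a‖ ^ 2 = T at hT s1 s2 s3 s4 t1 t2 t3 t4 ⊢
  have hcomb : ∀ w : (Obs N × Obs N) × (Obs N × Obs N), ‖w.1.1 - w.2.1‖ ^ 2 + ‖w.1.2 - w.2.2‖ ^ 2
      - ‖w.1.1 - w.2.2‖ ^ 2 - ‖w.2.1 - w.1.2‖ ^ 2 =
        -(2 * inner ℝ (w.1.1 - w.1.2) (w.2.1 - w.2.2)) := by
    intro w
    rw [norm_sub_rev w.2.1 w.1.2, norm_sub_sq_combination]
  have hD' := hD.const_mul (2 * l)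
  constructor
  · -- linearisation around `0`
    have e : ∀ w : (Obs N × Obs N) × (Obs N × Obs N), hCore (gaussKernel γ) w.1 w.2 =
        2 * l * inner ℝ (w.1.1 - w.1.2) (w.2.1 - w.2.2)
        + (Real.exp (-(l * ‖w.1.1 - w.2.1‖ ^ 2)) - 1 + l * ‖w.1.1 - w.2.1‖ ^ 2)
        + (Real.exp (-(l * ‖w.1.2 - w.2.2‖ ^ 2)) - 1 + l * ‖w.1.2 - w.2.2‖ ^ 2)
        - (Real.exp (-(l * ‖w.1.1 - w.2.2‖ ^ 2)) - 1 + l * ‖w.1.1 - w.2.2‖ ^ 2)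
        - (Real.exp (-(l * ‖w.2.1 - w.1.2‖ ^ 2)) - 1 + l * ‖w.2.1 - w.1.2‖ ^ 2) := by
      intro w
      rw [hh]
      linear_combination (-l) * hcomb w
    rw [hmmd, integral_congr_ae (ae_of_all _ e)]
    change |∫ w, _ ∂pairLaw a A - _| ≤ _
    rw [integral_sub (((hD'.add n1).add n2).sub n3).integrable n4.integrable,
      integral_sub ((hD'.add n1).add n2).integrable n3.integrable,
      integral_add (hD'.add n1).integrable n2.integrable,
      integral_add hD'.integrable n1.integrable, integral_const_mul, hD1]
    have hle : 0 ≤ √(256 * C) * (l ^ 2 * T ^ 2) := by positivity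
    rw [abs_le] at t1 t2 t3 t4 ⊢
    constructor <;> linarith
  · -- linearisation around the means
    have hR := ((m1.add m2).sub m3).sub m4
    have e : ∀ w : (Obs N × Obs N) × (Obs N × Obs N), hCore (gaussKernel γ) w.1 w.2 =
        (2 * l * inner ℝ (w.1.1 - w.1.2) (w.2.1 - w.2.2) + (R1 w + R2 w - R3 w - R4 w))
          + (c1 + c2 - c3 - c4) := by
      intro w
      rw [hh, e1, e2, e3, e4]
      linear_combination (-l) * hcomb w
    rw [xi₂, funext e]
    change |√Var[_; pairLaw a A] - _| ≤ _
    rw [variance_add_const (hD'.add hR).aestronglyMeasurable]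
    have hmain : √Var[fun w : (Obs N × Obs N) × (Obs N × Obs N) =>
        2 * l * inner ℝ (w.1.1 - w.1.2) (w.2.1 - w.2.2); pairLaw a A] =
          4 * l * √(shiftVar a A) := by
      rw [variance_const_mul, hD2,
        show (2 * l) ^ 2 * (4 * shiftVar a A) = (4 * l) ^ 2 * shiftVar a A by ring,
        Real.sqrt_mul (by positivity), Real.sqrt_sq (by positivity)]
    rw [← hmain]
    refine (abs_sqrt_variance_add_sub_le hD'.memLp_two hR.memLp_two).trans ?_
    have hbound := integral_sq_combination_le m1 m2 m3 m4 s1 s2 s3 s4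
    have e2 : 16 * (16 * C * (l ^ 4 * T ^ 2 * shiftVar a A)) =
        256 * C * (l ^ 2 * T * √(shiftVar a A)) ^ 2 := by
      rw [mul_pow _ (√_), Real.sq_sqrt hS]
      ring
    rw [e2] at hbound
    refine (Real.sqrt_le_sqrt hbound).trans ?_
    rw [Real.sqrt_mul (by positivity), Real.sqrt_sq (by positivity)]
    refine mul_le_mul_of_nonneg_right ?_ (by positivity)
    linarith

end MeanShift

/-! ### Asymptotics of the signal-to-noise ratio -/

theorem tendsto_div_one_of_abs_sub_le {x y e : ℕ → ℝ} (hy : ∀ᶠ n in atTop, 0 < y n)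
    (h : ∀ᶠ n in atTop, |x n - y n| ≤ e n * y n) (he : Tendsto e atTop (𝓝 0)) :
    Tendsto (fun n => x n / y n) atTop (𝓝 1) := by
  rw [tendsto_iff_dist_tendsto_zero]
  refine squeeze_zero' (Eventually.of_forall fun n => dist_nonneg) ?_ he
  filter_upwards [hy, h] with n h1 h2
  rw [Real.dist_eq, div_sub_one h1.ne', abs_div, abs_of_pos h1]
  exact (div_le_iff₀ h1).2 h2

/-- If `(tr A + ‖a‖²) / γ² → 0` and the signal `‖a‖²` is not negligible in `tr A + ‖a‖²`, then the
signal-to-noise ratio of `𝒩(0, A)` against `𝒩(a, A)` is asymptotically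
`‖a‖² / (2 (shiftVar a A)^{1/2})`. -/
theorem tendsto_signalToNoise_div (A : (N : ℕ) → Matrix (Fin N) (Fin N) ℝ)
    (hA : ∀ N, (A N).PosSemidef) (a : (N : ℕ) → EuclideanSpace ℝ (Fin N)) (γ : ℕ → ℝ)
    (hγ : ∀ᶠ N in atTop, γ N ≠ 0) (ha : ∀ᶠ N in atTop, 0 < ‖a N‖ ^ 2)
    (hS : ∀ᶠ N in atTop, 0 < shiftVar (a N) (A N)) (K : ℝ)
    (hK : ∀ᶠ N in atTop, (A N).trace + ‖a N‖ ^ 2 ≤ K * ‖a N‖ ^ 2)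
    (hlim : Tendsto (fun N => (γ N ^ 2)⁻¹ / 2 * ((A N).trace + ‖a N‖ ^ 2)) atTop (𝓝 0)) :
    Tendsto (fun N => signalToNoise (gaussKernel (γ N)) (multivariateGaussian 0 (A N))
      (multivariateGaussian (a N) (A N)) / (‖a N‖ ^ 2 / (2 * √(shiftVar (a N) (A N)))))
      atTop (𝓝 1) := by
  obtain ⟨C, hC, hb⟩ := exists_mmd_xi₂_bounds
  set l : ℕ → ℝ := fun N => (γ N ^ 2)⁻¹ / 2
  set T : ℕ → ℝ := fun N => (A N).trace + ‖a N‖ ^ 2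
  have hl : ∀ᶠ N in atTop, 0 < l N := by
    filter_upwards [hγ] with N h
    have := sq_pos_of_ne_zero h
    simp only [l]
    positivity
  have h1 : Tendsto (fun N => mmd (gaussKernel (γ N)) (multivariateGaussian 0 (A N))
      (multivariateGaussian (a N) (A N)) ^ 2 / (2 * l N * ‖a N‖ ^ 2)) atTop (𝓝 1) := by
    refine tendsto_div_one_of_abs_sub_le (e := fun N => C * |K| * (l N * T N)) ?_ ?_ ?_
    · filter_upwards [hl, ha] with N h1 h2
      positivity
    · filter_upwards [hl, ha, hK] with N h1 h2 h3
      refine (hb N (A N) (hA N) (a N) (γ N)).1.trans ?_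
      change C * (l N ^ 2 * T N ^ 2) ≤ _
      have hT : 0 ≤ T N := add_nonneg (hA N).trace_nonneg (sq_nonneg _)
      have h4 : T N ≤ |K| * ‖a N‖ ^ 2 :=
        h3.trans (mul_le_mul_of_nonneg_right (le_abs_self K) h2.le)
      calc C * (l N ^ 2 * T N ^ 2) = C * (l N ^ 2 * T N) * T N := by ring
        _ ≤ C * (l N ^ 2 * T N) * (|K| * ‖a N‖ ^ 2) := by gcongr
        _ ≤ 2 * (C * (l N ^ 2 * T N) * (|K| * ‖a N‖ ^ 2)) := by
          have : 0 ≤ C * (l N ^ 2 * T N) * (|K| * ‖a N‖ ^ 2) := by positivity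
          linarith
        _ = _ := by ring
    · simpa using hlim.const_mul (C * |K|)
  have h2 : Tendsto (fun N => √(xi₂ (gaussKernel (γ N)) (multivariateGaussian 0 (A N))
      (multivariateGaussian (a N) (A N))) / (4 * l N * √(shiftVar (a N) (A N))))
      atTop (𝓝 1) := by
    refine tendsto_div_one_of_abs_sub_le (e := fun N => C / 4 * (l N * T N)) ?_ ?_ ?_
    · filter_upwards [hl, hS] with N h1 h2
      positivity
    · filter_upwards with N
      refine (hb N (A N) (hA N) (a N) (γ N)).2.trans_eq ?_
      change C * (l N ^ 2 * T N * _) = _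
      ring
    · simpa using hlim.const_mul (C / 4)
  have h3 := h1.div h2 one_ne_zero
  rw [div_one] at h3
  refine h3.congr' ?_
  filter_upwards [hl, ha, hS] with N q1 q2 q3
  have q4 := Real.sqrt_pos.2 q3
  simp only [Pi.div_apply, signalToNoise]
  field_simp
  ring

section MeshAsymptotics

variable {d : ℕ} {D : TopologicalSpace.Compacts (EuclideanSpace ℝ (Fin d))}

/-- The covariance matrix of the observations at the points `t`. -/
def covMatrix {N : ℕ} (k₀ : D → D → ℝ) (t : Fin N → D) : Matrix (Fin N) (Fin N) ℝ :=
  Matrix.of fun i j => k₀ (t i) (t j)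

/-- The mean vector of the observations at the points `t`. -/
def meanVec {N : ℕ} (m : D → ℝ) (t : Fin N → D) : EuclideanSpace ℝ (Fin N) :=
  WithLp.toLp 2 fun i => m (t i)

theorem norm_meanVec_sq {N : ℕ} (m : D → ℝ) (t : Fin N → D) :
    ‖meanVec m t‖ ^ 2 = ∑ i, m (t i) ^ 2 := by
  rw [EuclideanSpace.real_norm_sq_eq]
  rfl

theorem meanShiftRatio_eq {N : ℕ} (m : D → ℝ) (k₀ : D → D → ℝ) (t : Fin N → D) (γ : ℝ) :
    meanShiftRatio m k₀ t γ = signalToNoise (gaussKernel γ)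
      (multivariateGaussian 0 (covMatrix k₀ t))
      (multivariateGaussian (meanVec m t) (covMatrix k₀ t)) := by
  have h : (WithLp.toLp 2 fun i => (0 : D → ℝ) (t i) : EuclideanSpace ℝ (Fin N)) = 0 := by
    ext i; simp
  unfold meanShiftRatio discretisedGP
  rw [h]
  rfl

/-- Asymptotics of the signal-to-noise ratio of a discretised process whose covariance function is
bounded on the diagonal. As `γ_N` grows faster than `√N`, the kernel acts linearly. -/
theorem tendsto_meanShiftRatio_div (t : (N : ℕ) → Fin N → D) (m : D → ℝ) (k₀ : D → D → ℝ)
    (hk : ∀ N, (covMatrix k₀ (t N)).PosSemidef) {B : ℝ} (hB : ∀ s, k₀ s s ≤ B) {q : ℝ} (hq : 0 < q)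
    (hm : Tendsto (fun N : ℕ => (1 / (N : ℝ)) * ∑ i, m (t N i) ^ 2) atTop (𝓝 q))
    (hS : ∀ᶠ N in atTop, 0 < shiftVar (meanVec m (t N)) (covMatrix k₀ (t N)))
    {α : ℝ} (hα : 1 / 2 < α) {γ : ℕ → ℝ} (hγ : (fun N : ℕ => (N : ℝ) ^ α) =O[atTop] γ) :
    Tendsto (fun N => meanShiftRatio m k₀ (t N) (γ N) /
      ((∑ i, m (t N i) ^ 2) / (2 * √(shiftVar (meanVec m (t N)) (covMatrix k₀ (t N))))))
      atTop (𝓝 1) := by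
  have hpos : ∀ᶠ N : ℕ in atTop, 0 < (N : ℝ) := by
    filter_upwards [eventually_gt_atTop 0] with N hN
    exact_mod_cast hN
  have htr : ∀ N, (covMatrix k₀ (t N)).trace ≤ |B| * N := by
    intro N
    rw [Matrix.trace]
    refine (Finset.sum_le_sum (g := fun _ => |B|) fun i _ => (hB _).trans (le_abs_self B)).trans ?_
    simp [mul_comm]
  have hlow : ∀ᶠ N : ℕ in atTop, q / 2 * N ≤ ∑ i, m (t N i) ^ 2 := by
    filter_upwards [hpos, hm.eventually (lt_mem_nhds (half_lt_self hq))] with N h1 h2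
    rw [one_div, inv_mul_eq_div, lt_div_iff₀ h1] at h2
    exact h2.le
  have hup : ∀ᶠ N : ℕ in atTop, ∑ i, m (t N i) ^ 2 ≤ 2 * q * N := by
    filter_upwards [hpos, hm.eventually (gt_mem_nhds (by linarith : q < 2 * q))] with N h1 h2
    rw [one_div, inv_mul_eq_div, div_lt_iff₀ h1] at h2
    exact h2.le
  obtain ⟨c, hc, hγc⟩ := hγ.exists_pos
  rw [isBigOWith_iff] at hγc
  have hγ' : ∀ᶠ N : ℕ in atTop, (N : ℝ) ^ α ≤ c * |γ N| := by
    filter_upwards [hγc] with N h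
    rwa [Real.norm_of_nonneg (by positivity), Real.norm_eq_abs] at h
  have hγ0 : ∀ᶠ N in atTop, γ N ≠ 0 := by
    filter_upwards [hγ', hpos] with N h1 h2 h3
    rw [h3, abs_zero, mul_zero] at h1
    exact absurd h1 (not_le.2 (Real.rpow_pos_of_pos h2 _))
  have key := tendsto_signalToNoise_div (fun N => covMatrix k₀ (t N)) hk
    (fun N => meanVec m (t N)) γ hγ0 ?_ hS (|B| / (q / 2) + 1) ?_ ?_
  · simp_rw [norm_meanVec_sq] at key
    simp_rw [meanShiftRatio_eq]
    exact key
  · filter_upwards [hpos, hlow] with N h1 h2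
    rw [norm_meanVec_sq]
    exact lt_of_lt_of_le (by positivity) h2
  · filter_upwards [hlow] with N h1
    rw [norm_meanVec_sq, add_mul, one_mul]
    refine add_le_add ((htr N).trans ?_) le_rfl
    calc |B| * N = |B| / (q / 2) * (q / 2 * N) := by field_simp
      _ ≤ _ := by gcongr
  · have hz : Tendsto (fun N : ℕ => c ^ 2 / 2 * (|B| + 2 * q) * (N : ℝ) ^ (-(2 * α - 1)))
        atTop (𝓝 0) := by
      have h := (tendsto_rpow_neg_atTop (y := 2 * α - 1) (by linarith)).comp
        (tendsto_natCast_atTop_atTop (R := ℝ))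
      simpa using h.const_mul (c ^ 2 / 2 * (|B| + 2 * q))
    refine squeeze_zero' (Eventually.of_forall fun N => ?_) ?_ hz
    · have := (hk N).trace_nonneg
      positivity
    · filter_upwards [hpos, hup, hγ', hγ0] with N h1 h2 h3 h4
      have hT : (covMatrix k₀ (t N)).trace + ‖meanVec m (t N)‖ ^ 2 ≤ (|B| + 2 * q) * N := by
        rw [norm_meanVec_sq, add_mul]
        exact add_le_add (htr N) h2
      have hpow : (N : ℝ) ^ (-(2 * α - 1)) = N / ((N : ℝ) ^ α) ^ 2 := by
        rw [← Real.rpow_natCast ((N : ℝ) ^ α), ← Real.rpow_mul h1.le, neg_sub,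
          Real.rpow_sub h1, Real.rpow_one]
        push_cast
        rw [mul_comm α 2]
      have hNα : 0 < (N : ℝ) ^ α := Real.rpow_pos_of_pos h1 _
      have hγi : (γ N ^ 2)⁻¹ ≤ c ^ 2 / ((N : ℝ) ^ α) ^ 2 := by
        have h5 : ((N : ℝ) ^ α) ^ 2 ≤ c ^ 2 * γ N ^ 2 := by
          rw [← sq_abs (γ N), ← mul_pow]
          exact pow_le_pow_left₀ hNα.le h3 2
        have h6 : 0 < γ N ^ 2 := by positivity
        rw [inv_eq_one_div, div_le_div_iff₀ h6 (by positivity)]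
        linarith
      calc (γ N ^ 2)⁻¹ / 2 * ((covMatrix k₀ (t N)).trace + ‖meanVec m (t N)‖ ^ 2)
          ≤ c ^ 2 / ((N : ℝ) ^ α) ^ 2 / 2 * ((|B| + 2 * q) * N) := by
            have := (hk N).trace_nonneg
            gcongr
        _ = _ := by
            rw [hpow]
            ring

/-! ### White noise -/

theorem covMatrix_whiteNoise {N : ℕ} {t : Fin N → D} (ht : Function.Injective t) :
    covMatrix whiteNoise t = 1 := by
  ext i j
  simp [covMatrix, whiteNoise, Matrix.one_apply, ht.eq_iff]

/-- For white noise `‖Σ‖_F² = N` and `aᵀ Σ a = ‖a‖²`. -/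
theorem shiftVar_one {N : ℕ} (a : EuclideanSpace ℝ (Fin N)) :
    shiftVar a (1 : Matrix (Fin N) (Fin N) ℝ) = N + ‖a‖ ^ 2 := by
  have h : ∀ i j : Fin N, (1 : Matrix (Fin N) (Fin N) ℝ) i j ^ 2 = if i = j then 1 else 0 := by
    intro i j
    rw [Matrix.one_apply]
    split_ifs <;> norm_num
  rw [shiftVar, Matrix.one_mulVec, EuclideanSpace.real_norm_sq_eq]
  simp_rw [h, dotProduct, ← sq]
  simp

theorem tendsto_meanShiftRatio_whiteNoise (t : (N : ℕ) → Fin N → D)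
    (ht : ∀ N, Function.Injective (t N)) (m : D → ℝ) {q : ℝ} (hq : 0 < q)
    (hm : Tendsto (fun N : ℕ => (1 / (N : ℝ)) * ∑ i, m (t N i) ^ 2) atTop (𝓝 q))
    {α : ℝ} (hα : 1 / 2 < α) {γ : ℕ → ℝ} (hγ : (fun N : ℕ => (N : ℝ) ^ α) =O[atTop] γ) :
    Tendsto (fun N : ℕ => meanShiftRatio m whiteNoise (t N) (γ N) /
      (√(N : ℝ) * q / (2 * √(1 + q)))) atTop (𝓝 1) := by
  have hpos : ∀ᶠ N : ℕ in atTop, 0 < (N : ℝ) := by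
    filter_upwards [eventually_gt_atTop 0] with N hN
    exact_mod_cast hN
  have hS : ∀ N, shiftVar (meanVec m (t N)) (covMatrix whiteNoise (t N)) =
      N + ∑ i, m (t N i) ^ 2 := fun N => by
    rw [covMatrix_whiteNoise (ht N), shiftVar_one, norm_meanVec_sq]
  have h1 := tendsto_meanShiftRatio_div t m whiteNoise
    (fun N => by rw [covMatrix_whiteNoise (ht N)]; exact Matrix.PosSemidef.one)
    (B := 1) (fun s => by simp [whiteNoise]) hq hm (by
      filter_upwards [hpos] with N h
      rw [hS]
      have : 0 ≤ ∑ i, m (t N i) ^ 2 := Finset.sum_nonneg fun i _ => sq_nonneg _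
      linarith) hα hγ
  simp_rw [hS] at h1
  set x : ℕ → ℝ := fun N => (1 / (N : ℝ)) * ∑ i, m (t N i) ^ 2
  have h2 : Tendsto (fun N => (x N / √(1 + x N)) / (q / √(1 + q))) atTop (𝓝 1) := by
    have h3 : Tendsto (fun N => (x N / √(1 + x N)) / (q / √(1 + q))) atTop
        (𝓝 ((q / √(1 + q)) / (q / √(1 + q)))) := by
      refine Tendsto.div_const (hm.div ?_ (by positivity)) _
      exact (Real.continuous_sqrt.tendsto _).comp (hm.const_add 1)
    rwa [div_self (by positivity)] at h3
  have h4 := h1.mul h2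
  rw [mul_one] at h4
  refine h4.congr' ?_
  filter_upwards [hpos, hm.eventually (lt_mem_nhds hq)] with N hN hx
  have hsum : ∑ i, m (t N i) ^ 2 = N * x N := by
    simp only [x]
    field_simp
  change 0 < x N at hx
  rw [hsum, show (N : ℝ) + N * x N = N * (1 + x N) by ring, Real.sqrt_mul hN.le]
  have hs1 : 0 < √(N : ℝ) := Real.sqrt_pos.2 hN
  have hs2 : 0 < √(1 + x N) := Real.sqrt_pos.2 (by linarith)
  have hs3 : 0 < √(1 + q) := Real.sqrt_pos.2 (by linarith)
  have hs4 : √(N : ℝ) ^ 2 = N := Real.sq_sqrt hN.le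
  field_simp
  rw [hs4]

end MeshAsymptotics

/-! ### Riemann sums of continuous functions of two variables -/

section TensorProducts

variable {X : Type*} [MetricSpace X] [CompactSpace X]

/-- The tensor product `(x, y) ↦ f x * g y`. -/
def tensor (f g : C(X, ℝ)) : C(X × X, ℝ) where
  toFun p := f p.1 * g p.2

/-- Linear combinations of tensor products are uniformly dense in `C(X × X)`, by the
Stone-Weierstrass theorem. -/
theorem span_tensor_topologicalClosure :
    (Submodule.span ℝ (Set.range fun p : C(X, ℝ) × C(X, ℝ) =>
      tensor p.1 p.2)).topologicalClosure = ⊤ := by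
  let M : Submonoid C(X × X, ℝ) :=
    { carrier := Set.range fun p : C(X, ℝ) × C(X, ℝ) => tensor p.1 p.2
      mul_mem' := by
        rintro _ _ ⟨p, rfl⟩ ⟨q, rfl⟩
        refine ⟨(p.1 * q.1, p.2 * q.2), ?_⟩
        ext x
        simp only [tensor, ContinuousMap.coe_mk, ContinuousMap.mul_apply]
        ring
      one_mem' := ⟨(1, 1), by ext x; simp [tensor]⟩ }
  have hM : Subalgebra.toSubmodule (Algebra.adjoin ℝ (M : Set C(X × X, ℝ))) =
      Submodule.span ℝ (M : Set C(X × X, ℝ)) := by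
    rw [Algebra.adjoin_eq_span, Submonoid.closure_eq]
  have hsep : (Algebra.adjoin ℝ (M : Set C(X × X, ℝ))).SeparatesPoints := by
    intro p q hpq
    have hd : p.1 ≠ q.1 ∨ p.2 ≠ q.2 := by
      by_contra! h
      exact hpq (Prod.ext h.1 h.2)
    rcases hd with h | h
    · refine ⟨_, ⟨tensor ⟨fun x => dist x q.1, by fun_prop⟩ 1,
        Algebra.subset_adjoin ⟨(_, _), rfl⟩, rfl⟩, ?_⟩
      simpa [tensor] using h
    · refine ⟨_, ⟨tensor 1 ⟨fun x => dist x q.2, by fun_prop⟩,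
        Algebra.subset_adjoin ⟨(_, _), rfl⟩, rfl⟩, ?_⟩
      simpa [tensor] using h
  have htop := ContinuousMap.subalgebra_topologicalClosure_eq_top_of_separatesPoints _ hsep
  refine Submodule.eq_top_iff'.2 fun K => ?_
  have hK : K ∈ (Algebra.adjoin ℝ (M : Set C(X × X, ℝ))).topologicalClosure := by
    rw [htop]; trivial
  rw [← SetLike.mem_coe, Subalgebra.topologicalClosure_coe] at hK
  rw [← SetLike.mem_coe, Submodule.topologicalClosure_coe]
  have e : ((Algebra.adjoin ℝ (M : Set C(X × X, ℝ)) : Subalgebra ℝ C(X × X, ℝ)) :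
      Set C(X × X, ℝ)) = (Submodule.span ℝ (M : Set C(X × X, ℝ)) : Set C(X × X, ℝ)) := by
    rw [← hM]; rfl
  rwa [e] at hK

end TensorProducts

section RiemannSums

variable {d : ℕ} {D : TopologicalSpace.Compacts (EuclideanSpace ℝ (Fin d))}
  {t : (N : ℕ) → Fin N → D} {V : Submodule ℝ (D → ℝ)}

/-- The Riemann scaling property for products, by polarisation. -/
theorem RiemannScaling.tendsto_mul (hR : RiemannScaling t V)
    (hV : ∀ f ∈ V, MemLp f 2 (lebesgueOn D)) {f g : D → ℝ} (hf : f ∈ V) (hg : g ∈ V) :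
    Tendsto (fun N : ℕ => (1 / (N : ℝ)) * ∑ i, f (t N i) * g (t N i)) atTop
      (𝓝 (∫ x, f x * g x ∂lebesgueOn D)) := by
  have h1 := hR _ (V.add_mem hf hg)
  have h2 := hR _ (V.sub_mem hf hg)
  have i1 : Integrable (fun x => (f + g) x ^ 2) (lebesgueOn D) :=
    (hV _ (V.add_mem hf hg)).integrable_sq
  have i2 : Integrable (fun x => (f - g) x ^ 2) (lebesgueOn D) :=
    (hV _ (V.sub_mem hf hg)).integrable_sq
  have h3 := (h1.sub h2).const_mul (1 / 4)
  have e : (1 / 4) * ((∫ x, (f + g) x ^ 2 ∂lebesgueOn D) - ∫ x, (f - g) x ^ 2 ∂lebesgueOn D) =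
      ∫ x, f x * g x ∂lebesgueOn D := by
    rw [← integral_sub i1 i2, ← integral_const_mul]
    refine integral_congr_ae (ae_of_all _ fun x => ?_)
    simp only [Pi.add_apply, Pi.sub_apply]
    ring
  rw [e] at h3
  refine h3.congr fun N => ?_
  rw [← mul_sub, ← Finset.sum_sub_distrib, mul_left_comm, Finset.mul_sum]
  congr 1
  refine Finset.sum_congr rfl fun i _ => ?_
  simp only [Pi.add_apply, Pi.sub_apply]
  ring

/-- `N⁻² ∑ᵢ ∑ⱼ φ(tᵢ) φ(tⱼ) K(tᵢ, tⱼ)`. -/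
noncomputable def doubleSum (t : (N : ℕ) → Fin N → D) (φ : D → ℝ) (K : C(D × D, ℝ)) (N : ℕ) : ℝ :=
  (1 / (N : ℝ)) ^ 2 * ∑ i, ∑ j, φ (t N i) * φ (t N j) * K (t N i, t N j)

/-- `∬ φ(x) φ(y) K(x, y) dx dy`. -/
noncomputable def doubleIntegral (φ : D → ℝ) (K : C(D × D, ℝ)) : ℝ :=
  ∫ p, φ p.1 * φ p.2 * K p ∂((lebesgueOn D).prod (lebesgueOn D))

theorem integrable_mul_mul_continuous {φ ψ : D → ℝ} (hφ : Integrable φ (lebesgueOn D))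
    (hψ : Integrable ψ (lebesgueOn D)) (K : C(D × D, ℝ)) :
    Integrable (fun p => φ p.1 * ψ p.2 * K p) ((lebesgueOn D).prod (lebesgueOn D)) :=
  (hφ.mul_prod hψ).mul_bdd (c := ‖K‖) K.continuous.aestronglyMeasurable
    (ae_of_all _ fun p => K.norm_coe_le_norm p)

theorem doubleSum_sub (φ : D → ℝ) (K L : C(D × D, ℝ)) (N : ℕ) :
    doubleSum t φ (K - L) N = doubleSum t φ K N - doubleSum t φ L N := by
  simp only [doubleSum, ContinuousMap.sub_apply, mul_sub, Finset.sum_sub_distrib]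

theorem doubleIntegral_sub {φ : D → ℝ} (hφ : Integrable φ (lebesgueOn D)) (K L : C(D × D, ℝ)) :
    doubleIntegral φ (K - L) = doubleIntegral φ K - doubleIntegral φ L := by
  rw [doubleIntegral, doubleIntegral, doubleIntegral, ← integral_sub
    (integrable_mul_mul_continuous hφ hφ K) (integrable_mul_mul_continuous hφ hφ L)]
  simp only [ContinuousMap.sub_apply, mul_sub]

theorem abs_doubleSum_le (φ : D → ℝ) (K : C(D × D, ℝ)) (N : ℕ) :
    |doubleSum t φ K N| ≤ ‖K‖ * ((1 / (N : ℝ)) * ∑ i, φ (t N i) ^ 2) := by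
  have h1 : |∑ i, ∑ j, φ (t N i) * φ (t N j) * K (t N i, t N j)| ≤
      ‖K‖ * (∑ i, |φ (t N i)|) ^ 2 := by
    rw [sq, Finset.sum_mul_sum, Finset.mul_sum]
    refine (Finset.abs_sum_le_sum_abs _ _).trans (Finset.sum_le_sum fun i _ => ?_)
    rw [Finset.mul_sum]
    refine (Finset.abs_sum_le_sum_abs _ _).trans (Finset.sum_le_sum fun j _ => ?_)
    rw [abs_mul, abs_mul, mul_comm]
    exact mul_le_mul_of_nonneg_right (K.norm_coe_le_norm _) (by positivity)
  have h2 : (∑ i, |φ (t N i)|) ^ 2 ≤ N * ∑ i, φ (t N i) ^ 2 := by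
    have h := sq_sum_le_card_mul_sum_sq (s := Finset.univ) (f := fun i => |φ (t N i)|)
    simpa [sq_abs] using h
  rw [doubleSum, abs_mul, abs_of_nonneg (by positivity)]
  have h3 : (1 / (N : ℝ)) ^ 2 * N ≤ 1 / (N : ℝ) := by
    rcases Nat.eq_zero_or_pos N with rfl | hN
    · simp
    · have : (0 : ℝ) < N := by exact_mod_cast hN
      field_simp
      exact le_rfl
  have h4 : 0 ≤ ∑ i, φ (t N i) ^ 2 := Finset.sum_nonneg fun i _ => sq_nonneg _
  calc (1 / (N : ℝ)) ^ 2 * |∑ i, ∑ j, φ (t N i) * φ (t N j) * K (t N i, t N j)|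
      ≤ (1 / (N : ℝ)) ^ 2 * (‖K‖ * (N * ∑ i, φ (t N i) ^ 2)) := by gcongr; exact h1.trans (by gcongr)
    _ = ‖K‖ * (((1 / (N : ℝ)) ^ 2 * N) * ∑ i, φ (t N i) ^ 2) := by ring
    _ ≤ _ := by gcongr

theorem abs_doubleIntegral_le {φ : D → ℝ} (hφ : Integrable φ (lebesgueOn D)) (K : C(D × D, ℝ)) :
    |doubleIntegral φ K| ≤ ‖K‖ * (∫ x, |φ x| ∂lebesgueOn D) ^ 2 := by
  have e := integral_prod_mul (μ := lebesgueOn D) (ν := lebesgueOn D) (fun x => |φ x|)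
    (fun x => |φ x|)
  rw [← Real.norm_eq_abs, doubleIntegral, sq, ← e, ← integral_const_mul]
  refine norm_integral_le_of_norm_le ((hφ.abs.mul_prod hφ.abs).const_mul _)
    (ae_of_all _ fun p => ?_)
  rw [norm_mul, norm_mul, mul_comm]
  exact mul_le_mul_of_nonneg_right (K.norm_coe_le_norm _) (by positivity)

/-- The Riemann scaling property extends to double sums with a continuous weight, as it does so for
tensor products, whose span is dense. -/
theorem RiemannScaling.tendsto_doubleSum (hR : RiemannScaling t V)
    (hVc : ∀ f : D → ℝ, Continuous f → f ∈ V)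
    (hV : ∀ f ∈ V, MemLp f 2 (lebesgueOn D)) {φ : D → ℝ} (hφ : φ ∈ V) (K : C(D × D, ℝ)) :
    Tendsto (doubleSum t φ K) atTop (𝓝 (doubleIntegral φ K)) := by
  have hφi : Integrable φ (lebesgueOn D) := (hV φ hφ).integrable (by norm_num)
  have hspan : ∀ L ∈ Submodule.span ℝ (Set.range fun p : C(D, ℝ) × C(D, ℝ) => tensor p.1 p.2),
      Tendsto (doubleSum t φ L) atTop (𝓝 (doubleIntegral φ L)) := by
    intro L hL
    induction hL using Submodule.span_induction with
    | mem L hL =>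
      obtain ⟨⟨f, g⟩, rfl⟩ := hL
      have h := (hR.tendsto_mul hV hφ (hVc f f.continuous)).mul
        (hR.tendsto_mul hV hφ (hVc g g.continuous))
      have e : doubleIntegral φ (tensor f g) =
          (∫ x, φ x * f x ∂lebesgueOn D) * ∫ x, φ x * g x ∂lebesgueOn D := by
        rw [← integral_prod_mul (fun x => φ x * f x) (fun x => φ x * g x), doubleIntegral]
        refine integral_congr_ae (ae_of_all _ fun p => ?_)
        simp only [tensor, ContinuousMap.coe_mk]
        ring
      rw [e]
      refine h.congr fun N => ?_
      rw [doubleSum, mul_mul_mul_comm, ← sq, Finset.sum_mul_sum]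
      congr 1
      refine Finset.sum_congr rfl fun i _ => Finset.sum_congr rfl fun j _ => ?_
      simp only [tensor, ContinuousMap.coe_mk]
      ring
    | zero =>
      have e : doubleSum t φ 0 = fun _ => 0 := by
        ext N
        simp [doubleSum]
      rw [e]
      simp [doubleIntegral]
    | add L L' _ _ h h' =>
      have e : doubleIntegral φ (L + L') = doubleIntegral φ L + doubleIntegral φ L' := by
        rw [doubleIntegral, doubleIntegral, doubleIntegral, ← integral_add
          (integrable_mul_mul_continuous hφi hφi L) (integrable_mul_mul_continuous hφi hφi L')]
        simp only [ContinuousMap.add_apply, mul_add]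
      rw [e]
      refine (h.add h').congr fun N => ?_
      simp only [doubleSum, ContinuousMap.add_apply, mul_add, Finset.sum_add_distrib]
    | smul c L _ h =>
      have e : doubleIntegral φ (c • L) = c * doubleIntegral φ L := by
        rw [doubleIntegral, doubleIntegral, ← integral_const_mul]
        refine integral_congr_ae (ae_of_all _ fun p => ?_)
        simp only [ContinuousMap.smul_apply, smul_eq_mul]
        ring
      rw [e]
      refine (h.const_mul c).congr fun N => ?_
      simp only [doubleSum, ContinuousMap.smul_apply, smul_eq_mul, Finset.mul_sum]
      refine Finset.sum_congr rfl fun i _ => Finset.sum_congr rfl fun j _ => ?_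
      ring
  set q := ∫ x, φ x ^ 2 ∂lebesgueOn D
  have hq : 0 ≤ q := integral_nonneg fun x => sq_nonneg _
  set r := (∫ x, |φ x| ∂lebesgueOn D) ^ 2
  have hr : 0 ≤ r := sq_nonneg _
  rw [Metric.tendsto_nhds]
  intro ε hε
  have hδ : 0 < ε / (2 * (q + 1 + r)) := by positivity
  have hK : K ∈ closure (Submodule.span ℝ (Set.range fun p : C(D, ℝ) × C(D, ℝ) =>
      tensor p.1 p.2) : Set C(D × D, ℝ)) := by
    rw [← Submodule.topologicalClosure_coe, span_tensor_topologicalClosure]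
    trivial
  obtain ⟨L, hL, hKL⟩ := Metric.mem_closure_iff.1 hK _ hδ
  rw [dist_eq_norm] at hKL
  have h1 := Metric.tendsto_nhds.1 (hspan L hL) (ε / 2) (by positivity)
  have h2 := (hR φ hφ).eventually (gt_mem_nhds (lt_add_one q))
  filter_upwards [h1, h2] with N h3 h4
  have h5 := abs_doubleSum_le (t := t) φ (K - L) N
  have h6 := abs_doubleIntegral_le hφi (K - L)
  rw [doubleSum_sub] at h5
  rw [doubleIntegral_sub hφi] at h6
  rw [Real.dist_eq] at h3 ⊢
  have h7 : ‖K - L‖ * ((1 / (N : ℝ)) * ∑ i, φ (t N i) ^ 2) ≤ ‖K - L‖ * (q + 1) := by gcongr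
  have h8 : ‖K - L‖ * (q + 1 + r) < ε / 2 := by
    have h9 := mul_lt_mul_of_pos_right hKL (by positivity : 0 < q + 1 + r)
    have e : ε / (2 * (q + 1 + r)) * (q + 1 + r) = ε / 2 := by field_simp
    rwa [e] at h9
  have h10 : doubleSum t φ K N - doubleIntegral φ K =
      (doubleSum t φ K N - doubleSum t φ L N) + (doubleSum t φ L N - doubleIntegral φ L)
        - (doubleIntegral φ K - doubleIntegral φ L) := by ring
  rw [h10]
  refine (abs_sub _ _).trans_lt (lt_of_le_of_lt (add_le_add_left (abs_add_le _ _) _) ?_)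
  nlinarith

end RiemannSums

/-! ### Square roots of positive operators -/

section SquareRoot

variable {H : Type*} [NormedAddCommGroup H] [InnerProductSpace ℝ H]

theorem norm_one_sub_le_one {T : H →L[ℝ] H} (hT : T.IsPositive) (h1 : ‖T‖ ≤ 1) :
    ‖1 - T‖ ≤ 1 := by
  refine ContinuousLinearMap.opNorm_le_bound _ zero_le_one fun x => ?_
  rw [one_mul]
  change ‖x - T x‖ ≤ ‖x‖
  -- `‖T x‖² ≤ ⟪T x, x⟫`, from the positivity of `T` at `x - T x`
  have h2 := hT.inner_nonneg_left (x - T x)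
  have h3 : inner ℝ (T (T x)) (T x) ≤ ‖T x‖ ^ 2 := by
    refine (real_inner_le_norm _ _).trans ?_
    have := T.le_of_opNorm_le h1 (T x)
    nlinarith [norm_nonneg (T x)]
  have h4 : inner ℝ (T (T x)) x = ‖T x‖ ^ 2 := by
    rw [hT.inner_left_eq_inner_right, real_inner_self_eq_norm_sq]
  rw [map_sub, inner_sub_left, inner_sub_right, inner_sub_right, real_inner_self_eq_norm_sq,
    h4] at h2
  refine le_of_sq_le_sq ?_ (norm_nonneg _)
  rw [norm_sub_sq_real, real_inner_comm]
  nlinarith [sq_nonneg ‖T x‖]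

/-- The iteration `y ↦ (1 + y²) / 2`, which increases to its fixed point `1`. -/
noncomputable def sqrtIterReal : ℕ → ℝ
  | 0 => 0
  | n + 1 => (1 + sqrtIterReal n ^ 2) / 2

/-- The iteration `Y ↦ (X + Y²) / 2`. If `X = 1 - T`, a fixed point `Y` satisfies `(1 - Y)² = T`. -/
noncomputable def sqrtIter (X : H →L[ℝ] H) : ℕ → H →L[ℝ] H
  | 0 => 0
  | n + 1 => (1 / 2 : ℝ) • (X + sqrtIter X n * sqrtIter X n)

theorem sqrtIterReal_mem (n : ℕ) : 0 ≤ sqrtIterReal n ∧ sqrtIterReal n ≤ 1 := by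
  induction n with
  | zero => simp [sqrtIterReal]
  | succ n ih =>
    rw [sqrtIterReal]
    constructor <;> nlinarith [ih.1, ih.2]

theorem commute_sqrtIter_left (X : H →L[ℝ] H) (n : ℕ) : Commute (sqrtIter X n) X := by
  induction n with
  | zero => exact Commute.zero_left X
  | succ n ih => exact ((Commute.refl X).add_left (ih.mul_left ih)).smul_left _

theorem commute_sqrtIter_succ (X : H →L[ℝ] H) (n : ℕ) :
    Commute (sqrtIter X n) (sqrtIter X (n + 1)) :=
  ((commute_sqrtIter_left X n).add_right
    ((Commute.refl _).mul_right (Commute.refl _))).smul_right _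

theorem norm_sqrtIter_le {X : H →L[ℝ] H} (hX : ‖X‖ ≤ 1) (n : ℕ) :
    ‖sqrtIter X n‖ ≤ sqrtIterReal n := by
  induction n with
  | zero => simp [sqrtIter, sqrtIterReal]
  | succ n ih =>
    rw [sqrtIter, sqrtIterReal, norm_smul]
    have h1 := norm_add_le X (sqrtIter X n * sqrtIter X n)
    have h2 := norm_mul_le (sqrtIter X n) (sqrtIter X n)
    have h3 : ‖sqrtIter X n‖ * ‖sqrtIter X n‖ ≤ sqrtIterReal n ^ 2 := by
      rw [sq]
      exact mul_le_mul ih ih (norm_nonneg _) (sqrtIterReal_mem n).1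
    norm_num
    linarith

theorem norm_sqrtIter_succ_sub_le {X : H →L[ℝ] H} (hX : ‖X‖ ≤ 1) (n : ℕ) :
    ‖sqrtIter X (n + 1) - sqrtIter X n‖ ≤ sqrtIterReal (n + 1) - sqrtIterReal n := by
  induction n with
  | zero =>
    have h := norm_sqrtIter_le hX 1
    simpa [sqrtIter, sqrtIterReal] using h
  | succ n ih =>
    have hc := (commute_sqrtIter_succ X n).eq
    have e : sqrtIter X (n + 1 + 1) - sqrtIter X (n + 1) = (1 / 2 : ℝ) •
        ((sqrtIter X (n + 1) + sqrtIter X n) * (sqrtIter X (n + 1) - sqrtIter X n)) := by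
      have e1 : sqrtIter X (n + 1 + 1) =
          (1 / 2 : ℝ) • (X + sqrtIter X (n + 1) * sqrtIter X (n + 1)) := rfl
      have e2 : sqrtIter X (n + 1) = (1 / 2 : ℝ) • (X + sqrtIter X n * sqrtIter X n) := rfl
      rw [e1]
      nth_rewrite 3 [e2]
      rw [← smul_sub, add_mul, mul_sub, mul_sub, hc]
      congr 1
      abel
    have e3 : sqrtIterReal (n + 1 + 1) - sqrtIterReal (n + 1) = 1 / 2 *
        ((sqrtIterReal (n + 1) + sqrtIterReal n) * (sqrtIterReal (n + 1) - sqrtIterReal n)) := by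
      have e1 : sqrtIterReal (n + 1 + 1) = (1 + sqrtIterReal (n + 1) ^ 2) / 2 := rfl
      have e2 : sqrtIterReal (n + 1) = (1 + sqrtIterReal n ^ 2) / 2 := rfl
      rw [e1]
      linear_combination -e2
    rw [e, e3, norm_smul]
    refine mul_le_mul (by norm_num) ((norm_mul_le _ _).trans ?_) (norm_nonneg _) (by norm_num)
    refine mul_le_mul ((norm_add_le _ _).trans ?_) ih (norm_nonneg _) ?_
    · exact add_le_add (norm_sqrtIter_le hX _) (norm_sqrtIter_le hX _)
    · exact add_nonneg (sqrtIterReal_mem _).1 (sqrtIterReal_mem _).1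

variable [CompleteSpace H]

theorem isSelfAdjoint_sqrtIter {X : H →L[ℝ] H} (hX : IsSelfAdjoint X) (n : ℕ) :
    IsSelfAdjoint (sqrtIter X n) := by
  induction n with
  | zero => exact IsSelfAdjoint.zero _
  | succ n ih =>
    refine IsSelfAdjoint.smul (IsSelfAdjoint.all _) (hX.add ?_)
    rw [← sq]
    exact ih.pow 2

/-- The square root of `T` is `1 - Y`, with `Y` the limit of the iteration `sqrtIter (1 - T)`, whose
steps are dominated by those of the scalar iteration. -/
theorem exists_positive_sqrt_of_norm_le_one {T : H →L[ℝ] H} (hT : T.IsPositive) (h1 : ‖T‖ ≤ 1) :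
    ∃ S : H →L[ℝ] H, S.IsPositive ∧ S ∘L S = T := by
  set X : H →L[ℝ] H := 1 - T
  have hX : ‖X‖ ≤ 1 := norm_one_sub_le_one hT h1
  have hXs : IsSelfAdjoint X := (IsSelfAdjoint.one _).sub hT.isSelfAdjoint
  have hsum : Summable fun n => sqrtIterReal (n + 1) - sqrtIterReal n := by
    refine summable_of_sum_range_le (c := 1)
      (fun n => (norm_nonneg _).trans (norm_sqrtIter_succ_sub_le hX n)) fun n => ?_
    rw [Finset.sum_range_sub]
    have := (sqrtIterReal_mem n).2
    simpa [sqrtIterReal] using this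
  have hcau : CauchySeq (sqrtIter X) := cauchySeq_of_dist_le_of_summable _ (fun n => by
    rw [dist_comm, dist_eq_norm]
    exact norm_sqrtIter_succ_sub_le hX n) hsum
  obtain ⟨Y, hY⟩ := cauchySeq_tendsto_of_complete hcau
  have hfix : Y = (1 / 2 : ℝ) • (X + Y * Y) := by
    refine tendsto_nhds_unique ((tendsto_add_atTop_iff_nat 1).2 hY) ?_
    exact ((hY.mul hY).const_add X).const_smul (1 / 2 : ℝ)
  have hYn : ‖Y‖ ≤ 1 := le_of_tendsto hY.norm (Eventually.of_forall fun n =>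
    (norm_sqrtIter_le hX n).trans (sqrtIterReal_mem n).2)
  have hYs : IsSelfAdjoint Y := by
    have hc : IsClosed {Z : H →L[ℝ] H | IsSelfAdjoint Z} :=
      isClosed_eq continuous_star continuous_id
    exact hc.mem_of_tendsto hY (Eventually.of_forall fun n => isSelfAdjoint_sqrtIter hXs n)
  refine ⟨1 - Y, ?_, ?_⟩
  · rw [ContinuousLinearMap.isPositive_iff']
    refine ⟨(IsSelfAdjoint.one _).sub hYs, fun x => ?_⟩
    change 0 ≤ inner ℝ (x - Y x) x
    rw [inner_sub_left, real_inner_self_eq_norm_sq]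
    have h2 := real_inner_le_norm (Y x) x
    have h3 := Y.le_of_opNorm_le hYn x
    nlinarith [norm_nonneg x]
  · change (1 - Y) * (1 - Y) = T
    have h2 : Y + Y = X + Y * Y := by
      nth_rewrite 1 2 [hfix]
      rw [← add_smul]
      norm_num
    have h3 : (1 - Y) * (1 - Y) = 1 - (Y + Y) + Y * Y := by noncomm_ring
    rw [h3, h2]
    simp only [X]
    abel

theorem exists_positive_sqrt {T : H →L[ℝ] H} (hT : T.IsPositive) :
    ∃ S : H →L[ℝ] H, S.IsPositive ∧ S ∘L S = T := by
  rcases eq_or_ne T 0 with rfl | hT0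
  · exact ⟨0, ContinuousLinearMap.isPositive_zero, by simp⟩
  have hn : 0 < ‖T‖ := norm_pos_iff.2 hT0
  obtain ⟨S, hS, hSS⟩ := exists_positive_sqrt_of_norm_le_one
    (hT.smul_of_nonneg (inv_nonneg.2 hn.le)) (by
      rw [norm_smul, norm_inv, norm_norm, inv_mul_cancel₀ hn.ne'])
  refine ⟨√‖T‖ • S, hS.smul_of_nonneg (Real.sqrt_nonneg _), ?_⟩
  rw [ContinuousLinearMap.smul_comp, ContinuousLinearMap.comp_smul, hSS, smul_smul, smul_smul,
    Real.mul_self_sqrt hn.le, mul_inv_cancel₀ hn.ne', one_smul]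

/-- `‖T^{1/2} x‖² = ⟪x, T x⟫`. Positive square roots exist, so `operatorSqrt` does not take its
default value. -/
theorem norm_operatorSqrt_sq {T : H →L[ℝ] H} (hT : T.IsPositive) (x : H) :
    ‖operatorSqrt T x‖ ^ 2 = inner ℝ x (T x) := by
  have h : ∃ S : H →L[ℝ] H, S.IsPositive ∧ S ∘L S = T := exists_positive_sqrt hT
  have e : operatorSqrt T = h.choose := by rw [operatorSqrt, dif_pos h]
  obtain ⟨h1, h2⟩ := h.choose_spec
  rw [e, ← real_inner_self_eq_norm_sq, h1.inner_left_eq_inner_right]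
  conv_rhs => rw [← h2]
  rfl

end SquareRoot

/-! ### The Hilbert-Schmidt norm of a covariance operator -/

/-- Orthonormal families in a separable space are countable, as the balls of radius `1/2` around
the vectors are disjoint. -/
theorem countable_of_orthonormal {H ι : Type*} [NormedAddCommGroup H] [InnerProductSpace ℝ H]
    [TopologicalSpace.SeparableSpace H] {v : ι → H} (hv : Orthonormal ℝ v) : Countable ι := by
  have hdisj : (Set.univ : Set ι).PairwiseDisjoint fun i => Metric.ball (v i) (1 / 2) := by
    intro i _ j _ hij
    rw [Function.onFun, Set.disjoint_left]
    intro x hi hj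
    rw [Metric.mem_ball, dist_comm] at hi
    rw [Metric.mem_ball] at hj
    have h1 : ‖v i - v j‖ < 1 := by
      rw [← dist_eq_norm]
      linarith [dist_triangle (v i) x (v j)]
    have h2 : ‖v i - v j‖ ^ 2 = 2 := by
      rw [norm_sub_sq_real, hv.1, hv.1, hv.2 hij]
      norm_num
    nlinarith [norm_nonneg (v i - v j)]
  exact Set.countable_univ_iff.1 (hdisj.countable_of_isOpen (fun i _ => Metric.isOpen_ball)
    fun i _ => ⟨v i, Metric.mem_ball_self (by norm_num)⟩)

section Covariance

variable {X : Type*} [MetricSpace X] [CompactSpace X] [MeasurableSpace X] [BorelSpace X]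
  (μ : Measure X) [IsFiniteMeasure μ] (k : C(X × X, ℝ))

theorem coeFn_covarianceOperator (y : Lp ℝ 2 μ) :
    covarianceOperator μ k y =ᵐ[μ] covarianceFun μ k y :=
  ContinuousMap.coeFn_toLp (p := 2) (𝕜 := ℝ) μ (covarianceFun μ k y)

theorem norm_covarianceOperator_sq (y : Lp ℝ 2 μ) :
    ‖covarianceOperator μ k y‖ ^ 2 = ∫ t, covarianceFun μ k y t ^ 2 ∂μ := by
  rw [← real_inner_self_eq_norm_sq, L2.inner_def]
  refine integral_congr_ae ?_
  filter_upwards [coeFn_covarianceOperator μ k y] with t ht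
  rw [ht, real_inner_self_eq_norm_sq, Real.norm_eq_abs, sq_abs]

theorem integrable_continuous_prod (K : C(X × X, ℝ)) : Integrable K (μ.prod μ) :=
  Integrable.of_bound K.continuous.aestronglyMeasurable ‖K‖
    (ae_of_all _ fun p => K.norm_coe_le_norm p)

/-- The section `k(·, t)` as an element of `L²`. -/
noncomputable def kernelSection (t : X) : Lp ℝ 2 μ :=
  ContinuousMap.toLp 2 μ ℝ ⟨fun s => k (s, t), by fun_prop⟩

theorem coeFn_kernelSection (t : X) : kernelSection μ k t =ᵐ[μ] fun s => k (s, t) :=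
  ContinuousMap.coeFn_toLp (p := 2) (𝕜 := ℝ) μ _

theorem inner_kernelSection (t : X) (y : Lp ℝ 2 μ) :
    inner ℝ (kernelSection μ k t) y = covarianceFun μ k y t := by
  rw [L2.inner_def]
  refine integral_congr_ae ?_
  filter_upwards [coeFn_kernelSection μ k t] with s hs
  rw [hs]
  simp [mul_comm]

theorem norm_kernelSection_sq (t : X) :
    ‖kernelSection μ k t‖ ^ 2 = ∫ s, k (s, t) ^ 2 ∂μ := by
  rw [← real_inner_self_eq_norm_sq, L2.inner_def]
  refine integral_congr_ae ?_
  filter_upwards [coeFn_kernelSection μ k t] with s hs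
  rw [hs, real_inner_self_eq_norm_sq, Real.norm_eq_abs, sq_abs]

/-- Parseval's identity for the sections `k(·, t)`, integrated over `t`. -/
theorem tsum_ofReal_norm_covarianceOperator_sq {ι : Type*} (b : HilbertBasis ι ℝ (Lp ℝ 2 μ)) :
    ∑' i, ENNReal.ofReal (‖covarianceOperator μ k (b i)‖ ^ 2) =
      ENNReal.ofReal (∫ p, k p ^ 2 ∂μ.prod μ) := by
  have : Fact ((2 : ENNReal) ≠ ⊤) := ⟨by simp⟩
  have hcount : Countable ι := countable_of_orthonormal b.orthonormal
  have hsq : Integrable (fun p => k p ^ 2) (μ.prod μ) := integrable_continuous_prod μ (k ^ 2)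
  have h1 : ∀ i, ENNReal.ofReal (‖covarianceOperator μ k (b i)‖ ^ 2) =
      ∫⁻ t, ENNReal.ofReal (covarianceFun μ k (b i) t ^ 2) ∂μ := by
    intro i
    rw [norm_covarianceOperator_sq, ofReal_integral_eq_lintegral_ofReal]
    · exact Integrable.of_bound ((covarianceFun μ k (b i)).continuous.pow 2).aestronglyMeasurable
        ‖covarianceFun μ k (b i) ^ 2‖
        (ae_of_all _ fun t => (covarianceFun μ k (b i) ^ 2).norm_coe_le_norm t)
    · exact ae_of_all _ fun t => sq_nonneg _
  simp_rw [h1]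
  have hmeas : ∀ i, AEMeasurable
      (fun t => ENNReal.ofReal (covarianceFun μ k (b i) t ^ 2)) μ := fun i =>
    ((covarianceFun μ k (b i)).continuous.pow 2).measurable.ennreal_ofReal.aemeasurable
  rw [← lintegral_tsum hmeas]
  have h2 : ∀ t, ∑' i, ENNReal.ofReal (covarianceFun μ k (b i) t ^ 2) =
      ENNReal.ofReal (∫ s, k (s, t) ^ 2 ∂μ) := by
    intro t
    have h := b.hasSum_inner_mul_inner (kernelSection μ k t) (kernelSection μ k t)
    rw [real_inner_self_eq_norm_sq, norm_kernelSection_sq] at h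
    have e : ∀ i, inner ℝ (kernelSection μ k t) (b i) * inner ℝ (b i) (kernelSection μ k t) =
        covarianceFun μ k (b i) t ^ 2 := by
      intro i
      rw [real_inner_comm (kernelSection μ k t) (b i), inner_kernelSection, sq]
    simp_rw [e] at h
    rw [← h.tsum_eq, ENNReal.ofReal_tsum_of_nonneg (fun i => sq_nonneg _) h.summable]
  simp_rw [h2]
  rw [← ofReal_integral_eq_lintegral_ofReal hsq.integral_prod_right
    (ae_of_all _ fun t => integral_nonneg fun s => sq_nonneg _), integral_prod_symm _ hsq]

/-- The square of the Hilbert-Schmidt norm of the covariance operator is `∬ k²`. The sum defining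
the norm converges, by `tsum_ofReal_norm_covarianceOperator_sq`, so no default value occurs. -/
theorem hilbertSchmidtNorm_covarianceOperator_sq :
    hilbertSchmidtNorm (covarianceOperator μ k) ^ 2 = ∫ p, k p ^ 2 ∂μ.prod μ := by
  set b := (exists_hilbertBasis ℝ (Lp ℝ 2 μ)).choose_spec.choose
  have h := congrArg ENNReal.toReal (tsum_ofReal_norm_covarianceOperator_sq μ k b)
  rw [ENNReal.tsum_toReal_eq fun i => ENNReal.ofReal_ne_top,
    ENNReal.toReal_ofReal (integral_nonneg fun p => sq_nonneg _)] at h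
  simp_rw [ENNReal.toReal_ofReal (sq_nonneg _)] at h
  rw [hilbertSchmidtNorm, Real.sq_sqrt (tsum_nonneg fun i => sq_nonneg _), ← h]

theorem integral_sq_pos_of_covarianceOperator_ne_zero (h : covarianceOperator μ k ≠ 0) :
    0 < ∫ p, k p ^ 2 ∂μ.prod μ := by
  refine lt_of_le_of_ne (integral_nonneg fun p => sq_nonneg _) fun h0 => h ?_
  have hb := (exists_hilbertBasis ℝ (Lp ℝ 2 μ)).choose_spec.choose
  have h1 := tsum_ofReal_norm_covarianceOperator_sq μ k hb
  rw [← h0, ENNReal.ofReal_zero, ENNReal.tsum_eq_zero] at h1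
  have h2 : ∀ i, covarianceOperator μ k (hb i) = 0 := by
    intro i
    have h3 := ENNReal.ofReal_eq_zero.1 (h1 i)
    have h4 : ‖covarianceOperator μ k (hb i)‖ = 0 := by
      nlinarith [norm_nonneg (covarianceOperator μ k (hb i))]
    exact norm_eq_zero.1 h4
  refine ContinuousLinearMap.ext_on (s := Set.range hb) ?_ ?_
  · rw [Submodule.dense_iff_topologicalClosure_eq_top]
    exact hb.dense_span
  · rintro _ ⟨i, rfl⟩
    rw [h2 i]
    rfl

/-- `⟪z, C_k y⟫ = ∬ y(s) z(t) k(s, t) ds dt`. -/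
theorem inner_covarianceOperator (y z : Lp ℝ 2 μ) :
    inner ℝ z (covarianceOperator μ k y) = ∫ p, y p.1 * z p.2 * k p ∂μ.prod μ := by
  have hy : Integrable y μ := (Lp.memLp y).integrable (by norm_num)
  have hz : Integrable z μ := (Lp.memLp z).integrable (by norm_num)
  have hi : Integrable (fun p : X × X => y p.1 * z p.2 * k p) (μ.prod μ) :=
    (hy.mul_prod hz).mul_bdd (c := ‖k‖) k.continuous.aestronglyMeasurable
      (ae_of_all _ fun p => k.norm_coe_le_norm p)
  rw [L2.inner_def, integral_prod_symm _ hi]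
  refine integral_congr_ae ?_
  filter_upwards [coeFn_covarianceOperator μ k y] with t ht
  rw [ht]
  change covarianceFun μ k y t * z t = _
  rw [covarianceFun, ContinuousMap.coe_mk, ← integral_mul_const]
  refine integral_congr_ae (ae_of_all _ fun s => ?_)
  simp only
  ring

theorem isSymmetric_covarianceOperator (hk : ∀ s t, k (s, t) = k (t, s)) (y z : Lp ℝ 2 μ) :
    inner ℝ (covarianceOperator μ k y) z = inner ℝ y (covarianceOperator μ k z) := by
  rw [real_inner_comm, inner_covarianceOperator, inner_covarianceOperator,
    ← integral_prod_swap]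
  refine integral_congr_ae (ae_of_all _ fun p => ?_)
  simp only [Prod.fst_swap, Prod.snd_swap]
  rw [show k p.swap = k p from hk _ _]
  ring

end Covariance

/-! ### Continuous covariance functions -/

section ContinuousCovariance

variable {d : ℕ} {D : TopologicalSpace.Compacts (EuclideanSpace ℝ (Fin d))}
  {t : (N : ℕ) → Fin N → D} {V : Submodule ℝ (D → ℝ)}

theorem posSemidef_covMatrix {N : ℕ} {k₀ : D → D → ℝ}
    (hk : (Matrix.of fun s t => k₀ s t).PosSemidef) (x : Fin N → D) :
    (covMatrix k₀ x).PosSemidef :=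
  hk.submatrix x

theorem inner_covarianceOperator_toLp (k₀ : C(D × D, ℝ)) {φ : D → ℝ}
    (hφ : MemLp φ 2 (lebesgueOn D)) :
    inner ℝ (hφ.toLp φ) (covarianceOperator (lebesgueOn D) k₀ (hφ.toLp φ)) =
      doubleIntegral φ k₀ := by
  rw [inner_covarianceOperator, doubleIntegral]
  refine integral_congr_ae ?_
  have h1 := (Measure.quasiMeasurePreserving_fst (μ := lebesgueOn D) (ν := lebesgueOn D)).ae
    hφ.coeFn_toLp
  have h2 := (Measure.quasiMeasurePreserving_snd (μ := lebesgueOn D) (ν := lebesgueOn D)).ae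
    hφ.coeFn_toLp
  filter_upwards [h1, h2] with p e1 e2
  rw [e1, e2]

theorem doubleSum_nonneg {k₀ : C(D × D, ℝ)} (hk : (Matrix.of fun s t => k₀ (s, t)).PosSemidef)
    (φ : D → ℝ) (N : ℕ) : 0 ≤ doubleSum t φ k₀ N := by
  have h := (posSemidef_covMatrix (k₀ := fun s t => k₀ (s, t)) hk (t N)).dotProduct_mulVec_nonneg
    fun i => φ (t N i)
  refine mul_nonneg (by positivity) (h.trans_eq ?_)
  simp only [star_trivial, dotProduct, Matrix.mulVec, covMatrix, Matrix.of_apply,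
    Finset.mul_sum]
  refine Finset.sum_congr rfl fun i _ => Finset.sum_congr rfl fun j _ => ?_
  ring

/-- The covariance operator is positive, as a limit of the discretised quadratic forms: these
converge for continuous functions, which are dense in `L²`. -/
theorem isPositive_covarianceOperator (hR : RiemannScaling t V)
    (hVc : ∀ f : D → ℝ, Continuous f → f ∈ V) (hV : ∀ f ∈ V, MemLp f 2 (lebesgueOn D))
    {k₀ : C(D × D, ℝ)} (hk : (Matrix.of fun s t => k₀ (s, t)).PosSemidef) :
    (covarianceOperator (lebesgueOn D) k₀).IsPositive := by
  have hsymm : ∀ s t, k₀ (s, t) = k₀ (t, s) := fun s t => by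
    have h := hk.isHermitian.apply t s
    simpa using h
  refine (ContinuousLinearMap.isPositive_iff _).2
    ⟨fun y z => isSymmetric_covarianceOperator (lebesgueOn D) k₀ hsymm y z, fun y => ?_⟩
  have hdense := ContinuousMap.toLp_denseRange ℝ (lebesgueOn D) (p := 2) ℝ (by simp)
  have hclosed : IsClosed {y : Lp ℝ 2 (lebesgueOn D) |
      0 ≤ inner ℝ (covarianceOperator (lebesgueOn D) k₀ y) y} :=
    isClosed_le continuous_const (by fun_prop)
  refine hdense.induction_on (p := fun y : Lp ℝ 2 (lebesgueOn D) =>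
    0 ≤ inner ℝ (covarianceOperator (lebesgueOn D) k₀ y) y) y hclosed fun f => ?_
  have hf : (f : D → ℝ) ∈ V := hVc f f.continuous
  have e : ContinuousMap.toLp 2 (lebesgueOn D) ℝ f = (hV f hf).toLp f := by
    refine Lp.ext ?_
    exact (ContinuousMap.coeFn_toLp (p := 2) (𝕜 := ℝ) _ f).trans (hV f hf).coeFn_toLp.symm
  rw [e, real_inner_comm, inner_covarianceOperator_toLp]
  exact ge_of_tendsto' (hR.tendsto_doubleSum hVc hV hf k₀) fun N => doubleSum_nonneg hk f N

/-- `N⁻² (‖Σ‖_F² + m_Nᵀ Σ m_N)` as a Riemann sum of `∬ k₀² + ∬ m(x) m(y) k₀(x, y)`. -/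
theorem shiftVar_div_sq (m : D → ℝ) (k₀ : C(D × D, ℝ)) (N : ℕ) :
    (1 / (N : ℝ)) ^ 2 * shiftVar (meanVec m (t N)) (covMatrix (fun s t => k₀ (s, t)) (t N)) =
      doubleSum t (fun _ => 1) (k₀ ^ 2) N + doubleSum t m k₀ N := by
  rw [doubleSum, doubleSum, ← mul_add, shiftVar]
  simp only [meanVec, dotProduct, Matrix.mulVec, covMatrix, Matrix.of_apply, Finset.mul_sum,
    ContinuousMap.pow_apply, one_mul]
  congr 2
  refine Finset.sum_congr rfl fun i _ => Finset.sum_congr rfl fun j _ => ?_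
  ring

theorem norm_toLp_sq {φ : D → ℝ} (hφ : MemLp φ 2 (lebesgueOn D)) :
    ‖hφ.toLp φ‖ ^ 2 = ∫ x, φ x ^ 2 ∂lebesgueOn D := by
  rw [← real_inner_self_eq_norm_sq, L2.inner_def]
  refine integral_congr_ae ?_
  filter_upwards [hφ.coeFn_toLp] with x hx
  rw [hx, real_inner_self_eq_norm_sq, Real.norm_eq_abs, sq_abs]

theorem tendsto_meanShiftRatio_continuous (hR : RiemannScaling t V)
    (hVc : ∀ f : D → ℝ, Continuous f → f ∈ V) (hV : ∀ f ∈ V, MemLp f 2 (lebesgueOn D))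
    {m : D → ℝ} (hm : m ∈ V) (hm₀ : (hV m hm).toLp m ≠ 0)
    {α : ℝ} (hα : 1 / 2 < α) {γ : ℕ → ℝ} (hγ : (fun N : ℕ => (N : ℝ) ^ α) =O[atTop] γ)
    {k₀ : C(D × D, ℝ)} (hk : (Matrix.of fun s t => k₀ (s, t)).PosSemidef)
    (hk₀ : covarianceOperator (lebesgueOn D) k₀ ≠ 0) :
    Tendsto (fun N : ℕ => meanShiftRatio m (fun s t => k₀ (s, t)) (t N) (γ N) /
        (‖(hV m hm).toLp m‖ ^ 2 /
          (2 * √(hilbertSchmidtNorm (covarianceOperator (lebesgueOn D) k₀) ^ 2 +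
            ‖operatorSqrt (covarianceOperator (lebesgueOn D) k₀) ((hV m hm).toLp m)‖ ^ 2))))
      atTop (𝓝 1) := by
  have hC := isPositive_covarianceOperator hR hVc hV hk
  set s := hilbertSchmidtNorm (covarianceOperator (lebesgueOn D) k₀) ^ 2 +
    ‖operatorSqrt (covarianceOperator (lebesgueOn D) k₀) ((hV m hm).toLp m)‖ ^ 2 with hs_def
  have hs : 0 < s := by
    have h := integral_sq_pos_of_covarianceOperator_ne_zero _ _ hk₀
    rw [← hilbertSchmidtNorm_covarianceOperator_sq] at h
    exact add_pos_of_pos_of_nonneg h (sq_nonneg _)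
  set q := ‖(hV m hm).toLp m‖ ^ 2 with hq_def
  have hq : 0 < q := by
    have := norm_pos_iff.2 hm₀
    positivity
  have hmq : Tendsto (fun N : ℕ => (1 / (N : ℝ)) * ∑ i, m (t N i) ^ 2) atTop (𝓝 q) := by
    rw [hq_def, norm_toLp_sq]
    exact hR m hm
  set S : ℕ → ℝ := fun N => shiftVar (meanVec m (t N)) (covMatrix (fun s t => k₀ (s, t)) (t N))
  have hSs : Tendsto (fun N : ℕ => (1 / (N : ℝ)) ^ 2 * S N) atTop (𝓝 s) := by
    have h1 := hR.tendsto_doubleSum hVc hV (hVc (fun _ => 1) continuous_const) (k₀ ^ 2)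
    have h2 := hR.tendsto_doubleSum hVc hV hm k₀
    have e1 : doubleIntegral (fun _ => 1) (k₀ ^ 2) =
        hilbertSchmidtNorm (covarianceOperator (lebesgueOn D) k₀) ^ 2 := by
      rw [hilbertSchmidtNorm_covarianceOperator_sq, doubleIntegral]
      simp
    rw [e1] at h1
    rw [← inner_covarianceOperator_toLp k₀ (hV m hm), ← norm_operatorSqrt_sq hC] at h2
    exact (h1.add h2).congr fun N => (shiftVar_div_sq m k₀ N).symm
  have hpos : ∀ᶠ N : ℕ in atTop, 0 < (N : ℝ) := by
    filter_upwards [eventually_gt_atTop 0] with N hN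
    exact_mod_cast hN
  have hSpos : ∀ᶠ N : ℕ in atTop, 0 < S N := by
    filter_upwards [hpos, hSs.eventually (lt_mem_nhds hs)] with N h1 h2
    exact pos_of_mul_pos_right h2 (by positivity)
  have h1 := tendsto_meanShiftRatio_div t m (fun s t => k₀ (s, t))
    (fun N => posSemidef_covMatrix hk (t N)) (B := ‖k₀‖)
    (fun x => (le_abs_self _).trans (k₀.norm_coe_le_norm (x, x))) hq hmq hSpos hα hγ
  set x : ℕ → ℝ := fun N => (1 / (N : ℝ)) * ∑ i, m (t N i) ^ 2
  set y : ℕ → ℝ := fun N => (1 / (N : ℝ)) ^ 2 * S N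
  have h2 : Tendsto (fun N => (x N / (2 * √(y N))) / (q / (2 * √s))) atTop (𝓝 1) := by
    have h3 : Tendsto (fun N => (x N / (2 * √(y N))) / (q / (2 * √s))) atTop
        (𝓝 ((q / (2 * √s)) / (q / (2 * √s)))) := by
      refine Tendsto.div_const (hmq.div ?_ (by positivity)) _
      exact ((Real.continuous_sqrt.tendsto _).comp hSs).const_mul 2
    rwa [div_self (by positivity)] at h3
  have h4 := h1.mul h2
  rw [mul_one] at h4
  refine h4.congr' ?_
  filter_upwards [hpos, hSpos, hmq.eventually (lt_mem_nhds hq)] with N hN hS hx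
  change 0 < x N at hx
  have hsum : ∑ i, m (t N i) ^ 2 = N * x N := by
    simp only [x]
    field_simp
  have hy : √(y N) = (1 / (N : ℝ)) * √(S N) := by
    simp only [y]
    rw [Real.sqrt_mul (by positivity), Real.sqrt_sq (by positivity)]
  have hs1 : 0 < √(S N) := Real.sqrt_pos.2 hS
  have hs2 : 0 < √s := Real.sqrt_pos.2 hs
  change meanShiftRatio _ _ _ _ / (_ / (2 * √(S N))) * _ = _
  rw [hsum, hy]
  field_simp

end ContinuousCovariance

end KernelTest

open KernelTest in
theorem proposition3p1 {d : ℕ} (D : TopologicalSpace.Compacts (EuclideanSpace ℝ (Fin d)))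
    (t : (N : ℕ) → Fin N → D) (ht : ∀ N, Function.Injective (t N))
    (V : Submodule ℝ (D → ℝ)) (hVc : ∀ f : D → ℝ, Continuous f → f ∈ V)
    (hV : ∀ f ∈ V, MemLp f 2 (lebesgueOn D)) (hR : RiemannScaling t V)
    (m : D → ℝ) (hm : m ∈ V) (hm₀ : (hV m hm).toLp m ≠ 0)
    (α : ℝ) (hα : 1 / 2 < α) (γ : ℕ → ℝ) (hγ : (fun N : ℕ => (N : ℝ) ^ α) =O[atTop] γ) :
    Tendsto (fun N : ℕ => meanShiftRatio m whiteNoise (t N) (γ N) /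
        (√(N : ℝ) * ‖(hV m hm).toLp m‖ ^ 2 / (2 * √(1 + ‖(hV m hm).toLp m‖ ^ 2))))
      atTop (𝓝 1) ∧
    ∀ k₀ : C(D × D, ℝ), (Matrix.of fun s t => k₀ (s, t)).PosSemidef →
      covarianceOperator (lebesgueOn D) k₀ ≠ 0 →
      Tendsto (fun N : ℕ => meanShiftRatio m (fun s t => k₀ (s, t)) (t N) (γ N) /
          (‖(hV m hm).toLp m‖ ^ 2 /
            (2 * √(hilbertSchmidtNorm (covarianceOperator (lebesgueOn D) k₀) ^ 2 +
              ‖operatorSqrt (covarianceOperator (lebesgueOn D) k₀) ((hV m hm).toLp m)‖ ^ 2))))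
        atTop (𝓝 1) := by
  refine ⟨?_, fun k₀ hk hk₀ => tendsto_meanShiftRatio_continuous hR hVc hV hm hm₀ hα hγ hk hk₀⟩
  have hq : 0 < ‖(hV m hm).toLp m‖ ^ 2 := by
    have := norm_pos_iff.2 hm₀
    positivity
  refine tendsto_meanShiftRatio_whiteNoise t ht m hq ?_ hα hγ
  rw [norm_toLp_sq]
  exact hR m hm
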